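/- Let $X,Y,K,D,d\ge 0$ be integers with $D\ge1$, put $Z=K+1$ and $J=X+YZ$. For each $x\in[X]$ let $\rho_x$ be a $D$-dimensional quantum state (a positive semidefinite matrix on $\mathbb C^D$ of trace $1$), and for each $y\in[Y]$ let $(E_{yz})_{z=1}^{Z}$ be a $D$-dimensional POVM (positive semidefinite matrices on $\mathbb C^D$ with $\sum_{z=1}^Z E_{yz}=I$). Let $\varepsilon^{(y)}_1\ge\varepsilon^{(y)}_2\ge\dots\ge\varepsilon^{(y)}_D$ be the eigenvalues, with multiplicity, of $\sum_{z=1}^{Z-1}E_{yz}$. Assume that for some integer $j^*>0$ and some real $b>0$, $$\varepsilon^{(y)}_{j^*+j}\le e^{-bj}\qquad\text{for all } y\in[Y] \text{ and all integers } j>0 \text{ with } j^*+j\le D .$$ Let $\varepsilon\in(0,1/2]$ and suppose that $$d\ \ge\ \frac{128}{\varepsilon^2}\ln(4JD)\qquad\text{and}\qquad d\ \ge\ \frac{128}{\varepsilon^2}\Bigl(j^*+\frac1b\ln\frac8\varepsilon\Bigr)$$ (the first condition being void if $J=0$). Then there exist $d$-dimensional quantum states $\rho'_x$ $(x\in[X])$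 and $d$-dimensional POVMs $(E'_{yz})_{z=1}^Z$ $(y\in[Y])$ such that for all $x\in[X]$ and $y\in[Y]$ $$\bigl|\mathrm{tr}(\rho'_xE'_{yz})-\mathrm{tr}(\rho_xE_{yz})\bigr|\le 200\,\varepsilon\,\mathrm{tr}(E_{yz})\quad\text{for all } z\in[Z-1],$$ $$\bigl|\mathrm{tr}(\rho'_xE'_{yZ})-\mathrm{tr}(\rho_xE_{yZ})\bigr|\le 200\,\varepsilon\,\mathrm{tr}(I-E_{yZ}).$$ Moreover, such a compressed model can be computed in randomized polynomial time: there are one program $P$ of a random access machine with exact real arithmetic ($+,-,\times,/$ and comparisons at unit cost) and access to independent standard Gaussian random numbers, and one polynomial $p$, such that for all data as above, on input $X,Y,Z,D,d,\varepsilon,(\rho_x),(E_{yz})$, the program $P$ always stops after at most $p(X+Y+Z+\max(D,d))$ steps, and with probability at least $2/3$ its output is a collection of $d$-dimensional states $\rho'_x$ and POVMs $(E'_{yz})_z$ with the properties above. -/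

import Mathlib

open scoped BigOperators ComplexOrder

noncomputable section

/-! ### Quantum models -/

/-- A `D`-dimensional quantum state: a positive semidefinite matrix on `ℂ^D` of trace one. -/
structure IsQuantumState {D : ℕ} (ρ : Matrix (Fin D) (Fin D) ℂ) : Prop where
  posSemidef : ρ.PosSemidef
  trace_eq_one : ρ.trace = 1

/-- A `D`-dimensional POVM with `Z` outcomes: positive semidefinite matrices that sum up to `I`. -/
structure IsPOVM {D Z : ℕ} (E : Fin Z → Matrix (Fin D) (Fin D) ℂ) : Prop where
  posSemidef : ∀ z, (E z).PosSemidef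
  sum_eq_one : ∑ z, E z = 1

/-- The operator `∑_{z < Z} E_z`, for a measurement with `Z = K + 1` outcomes: the sum over all
outcomes but the last one. -/
def sumButLast {D K : ℕ} (E : Fin (K + 1) → Matrix (Fin D) (Fin D) ℂ) :
    Matrix (Fin D) (Fin D) ℂ :=
  ∑ k : Fin K, E k.castSucc

/-- `M` is Hermitian and its eigenvalues `ε_1 ≥ ε_2 ≥ ... ≥ ε_D` (with multiplicity, in descending
order) satisfy `ε_{j* + j} ≤ exp (-b j)` for every `j > 0` for which `ε_{j* + j}` exists.
`Matrix.IsHermitian.eigenvalues₀` lists the eigenvalues in descending order, starting at index `0`,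
so that `ε_n` is its value at the index `i` with `i + 1 = n`. -/
def HasExpTail {D : ℕ} (M : Matrix (Fin D) (Fin D) ℂ) (jstar : ℕ) (b : ℝ) : Prop :=
  ∃ hM : M.IsHermitian, ∀ (i : Fin (Fintype.card (Fin D))) (j : ℕ), 0 < j →
    (i : ℕ) + 1 = jstar + j → hM.eigenvalues₀ i ≤ Real.exp (-(b * j))

/-- `ρ'`, `E'` is a `d`-dimensional quantum model that reproduces the outcome probabilities of the
`D`-dimensional quantum model `ρ`, `E` up to the error `200 ε tr(E_{yz})` for the outcomes `z < Z`
and up to the error `200 ε tr(I - E_{yZ})` for the last outcome `z = Z`, where `Z = K + 1`.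
(All the traces below are real numbers when `ρ`, `E` is a quantum model.) -/
structure IsCompressedModel {X Y K D d : ℕ} (ε : ℝ)
    (ρ : Fin X → Matrix (Fin D) (Fin D) ℂ)
    (E : Fin Y → Fin (K + 1) → Matrix (Fin D) (Fin D) ℂ)
    (ρ' : Fin X → Matrix (Fin d) (Fin d) ℂ)
    (E' : Fin Y → Fin (K + 1) → Matrix (Fin d) (Fin d) ℂ) : Prop where
  state : ∀ x, IsQuantumState (ρ' x)
  povm : ∀ y, IsPOVM (E' y)
  error : ∀ x y (k : Fin K),
    ‖(ρ' x * E' y k.castSucc).trace - (ρ x * E y k.castSucc).trace‖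
      ≤ 200 * ε * (E y k.castSucc).trace.re
  error_last : ∀ x y,
    ‖(ρ' x * E' y (Fin.last K)).trace - (ρ x * E y (Fin.last K)).trace‖
      ≤ 200 * ε * (1 - E y (Fin.last K)).trace.re

/-! ### Randomized algorithms over the reals

Programs for a random access machine with exact real arithmetic. It has natural number variables
(used as sizes, loop counters and array indices; only addition and truncated subtraction are
available on them) and arrays of real numbers, and it can draw independent standard Gaussian random
numbers. Each operation, each memory access, each test, each draw and each pass through a loop
costs at least one step. -/

namespace RealRAM

/-- Expressions for natural numbers. -/
inductive IdxExp : Type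
  | const (n : ℕ)
  | var (v : ℕ)
  | add (e f : IdxExp)
  | sub (e f : IdxExp)

/-- The value of an index expression, given the values of the natural number variables. -/
def IdxExp.eval (σ : ℕ → ℕ) : IdxExp → ℕ
  | .const n => n
  | .var v => σ v
  | .add e f => e.eval σ + f.eval σ
  | .sub e f => e.eval σ - f.eval σ

/-- The number of steps for the evaluation of an index expression. -/
def IdxExp.cost : IdxExp → ℕ
  | .const _ => 1
  | .var _ => 1
  | .add e f => e.cost + f.cost + 1
  | .sub e f => e.cost + f.cost + 1

/-- The contents of the real memory: `m a [i₁, ..., iₙ]` is the entry with the indices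
`i₁, ..., iₙ` of the array with the name `a`. -/
abbrev Mem : Type := ℕ → List ℕ → ℝ

/-- Expressions for real numbers: natural numbers, array entries, and the four operations. -/
inductive RealExp : Type
  | ofIdx (e : IdxExp)
  | cell (a : ℕ) (is : List IdxExp)
  | add (e f : RealExp)
  | sub (e f : RealExp)
  | mul (e f : RealExp)
  | div (e f : RealExp)

/-- The value of a real expression; a division by zero returns zero. -/
def RealExp.eval (σ : ℕ → ℕ) (m : Mem) : RealExp → ℝ
  | .ofIdx e => (e.eval σ : ℝ)
  | .cell a is => m a (is.map (IdxExp.eval σ))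
  | .add e f => e.eval σ m + f.eval σ m
  | .sub e f => e.eval σ m - f.eval σ m
  | .mul e f => e.eval σ m * f.eval σ m
  | .div e f => e.eval σ m / f.eval σ m

/-- The number of steps for the computation of the address of an array entry. -/
def addrCost (is : List IdxExp) : ℕ := (is.map IdxExp.cost).sum + 1

/-- The number of steps for the evaluation of a real expression. -/
def RealExp.cost : RealExp → ℕ
  | .ofIdx e => e.cost + 1
  | .cell _ is => addrCost is
  | .add e f => e.cost + f.cost + 1
  | .sub e f => e.cost + f.cost + 1
  | .mul e f => e.cost + f.cost + 1
  | .div e f => e.cost + f.cost + 1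

/-- Tests: comparisons of two natural numbers or of two real numbers. -/
inductive Test : Type
  | idxLe (e f : IdxExp)
  | realLe (e f : RealExp)

/-- The outcome of a test. -/
def Test.Holds (σ : ℕ → ℕ) (m : Mem) : Test → Prop
  | .idxLe e f => e.eval σ ≤ f.eval σ
  | .realLe e f => e.eval σ m ≤ f.eval σ m

/-- The number of steps for a test. -/
def Test.cost : Test → ℕ
  | .idxLe e f => e.cost + f.cost + 1
  | .realLe e f => e.cost + f.cost + 1

/-- Programs. `setIdx v e` and `setCell a is e` are assignments, `sample a is` stores a fresh
standard Gaussian random number in an array entry, and `loop v e p` runs `p` for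
`v = 0, 1, ..., n - 1`, where `n` is the value of `e` at the entrance of the loop. -/
inductive Prog : Type
  | skip
  | seq (p q : Prog)
  | setIdx (v : ℕ) (e : IdxExp)
  | setCell (a : ℕ) (is : List IdxExp) (e : RealExp)
  | sample (a : ℕ) (is : List IdxExp)
  | ite (t : Test) (p q : Prog)
  | loop (v : ℕ) (e : IdxExp) (p : Prog)

/-- The state of the machine: the variables, the memory, the number of random numbers drawn so far
and the number of steps made so far. -/
structure State : Type where
  idx : ℕ → ℕ
  mem : Mem
  drawn : ℕ
  steps : ℕ

/-- Let `n` steps pass. -/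
def State.tick (s : State) (n : ℕ) : State := { s with steps := s.steps + n }

/-- Assign a value to a variable. -/
def State.putIdx (s : State) (v n : ℕ) : State := { s with idx := Function.update s.idx v n }

/-- Store a value in an array entry. -/
def State.putCell (s : State) (a : ℕ) (is : List ℕ) (r : ℝ) : State :=
  { s with mem := Function.update s.mem a (Function.update (s.mem a) is r) }

open scoped Classical in
/-- The state after a run of a program that starts in the state `s` and whose source of randomness
returns the numbers `ω 0, ω 1, ω 2, ...` one after the other. -/
def Prog.run (ω : ℕ → ℝ) : Prog → State → State
  | .skip, s => s
  | .seq p q, s => q.run ω (p.run ω s)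
  | .setIdx v e, s => (s.putIdx v (e.eval s.idx)).tick (e.cost + 1)
  | .setCell a is e, s =>
      (s.putCell a (is.map (IdxExp.eval s.idx)) (e.eval s.idx s.mem)).tick
        (addrCost is + e.cost + 1)
  | .sample a is, s =>
      ({ s.putCell a (is.map (IdxExp.eval s.idx)) (ω s.drawn) with drawn := s.drawn + 1 }).tick
        (addrCost is + 1)
  | .ite t p q, s =>
      if t.Holds s.idx s.mem then p.run ω (s.tick (t.cost + 1)) else q.run ω (s.tick (t.cost + 1))
  | .loop v e p, s =>
      (List.range (e.eval s.idx)).foldl (fun s' i => p.run ω ((s'.putIdx v i).tick 1))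
        (s.tick (e.cost + 1))

/-- The law of the source of randomness: independent standard Gaussian random numbers. -/
def gaussianSource : MeasureTheory.Measure (ℕ → ℝ) :=
  MeasureTheory.Measure.infinitePi fun _ : ℕ => ProbabilityTheory.gaussianReal 0 1

/-- The entry `(i, j)` of a matrix, and `0` for indices that are out of range. -/
def entry {D : ℕ} (M : Matrix (Fin D) (Fin D) ℂ) (i j : ℕ) : ℂ :=
  if h : i < D ∧ j < D then M ⟨i, h.1⟩ ⟨j, h.2⟩ else 0

/-- The memory at the start: the array `0` holds `ε`, the arrays `1` and `2` hold the real and the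
imaginary parts of the entries of the matrices `ρ x`, the arrays `3` and `4` those of the matrices
`E y z`, and every other entry of every array is `0`. -/
def inputMem {X Y Z D : ℕ} (ε : ℝ) (ρ : Fin X → Matrix (Fin D) (Fin D) ℂ)
    (E : Fin Y → Fin Z → Matrix (Fin D) (Fin D) ℂ) : Mem
  | 0, [] => ε
  | 1, [x, i, j] => if h : x < X then (entry (ρ ⟨x, h⟩) i j).re else 0
  | 2, [x, i, j] => if h : x < X then (entry (ρ ⟨x, h⟩) i j).im else 0
  | 3, [y, z, i, j] => if h : y < Y ∧ z < Z then (entry (E ⟨y, h.1⟩ ⟨z, h.2⟩) i j).re else 0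
  | 4, [y, z, i, j] => if h : y < Y ∧ z < Z then (entry (E ⟨y, h.1⟩ ⟨z, h.2⟩) i j).im else 0
  | _, _ => 0

/-- The variables at the start: the variables `0, ..., 4` hold `X`, `Y`, `Z`, `D` and the dimension
`d` of the model to be computed, and every other variable is `0`. -/
def inputIdx (X Y Z D d : ℕ) : ℕ → ℕ
  | 0 => X
  | 1 => Y
  | 2 => Z
  | 3 => D
  | 4 => d
  | _ => 0

/-- The state of the machine at the start. -/
def inputState {X Y Z D : ℕ} (d : ℕ) (ε : ℝ) (ρ : Fin X → Matrix (Fin D) (Fin D) ℂ)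
    (E : Fin Y → Fin Z → Matrix (Fin D) (Fin D) ℂ) : State where
  idx := inputIdx X Y Z D d
  mem := inputMem ε ρ E
  drawn := 0
  steps := 0

/-- The `d`-dimensional matrices `ρ' x` returned by the machine: the real and the imaginary parts of
their entries are in the arrays `5` and `6`. -/
def outputRho (X d : ℕ) (s : State) : Fin X → Matrix (Fin d) (Fin d) ℂ :=
  fun x => Matrix.of fun i j => ⟨s.mem 5 [x, i, j], s.mem 6 [x, i, j]⟩

/-- The `d`-dimensional matrices `E' y z` returned by the machine: the real and the imaginary parts
of their entries are in the arrays `7` and `8`. -/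
def outputE (Y Z d : ℕ) (s : State) : Fin Y → Fin Z → Matrix (Fin d) (Fin d) ℂ :=
  fun y z => Matrix.of fun i j => ⟨s.mem 7 [y, z, i, j], s.mem 8 [y, z, i, j]⟩

end RealRAM

end

noncomputable section

namespace GaussianCompression

open MeasureTheory ProbabilityTheory

/-! ### Concentration of the norm of a Gaussian random vector -/

/-! The compression is a Johnson-Lindenstrauss map. With a real `d × D` Gaussian matrix `G`, each
state becomes `G ρ Gᵀ` divided by its trace, each effect with `z < Z` becomes `G E Gᵀ / (d (1 + 18
ε))`, and the last effect is what is missing to the identity. Two things must hold with probability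
at least `2/3`.

Accuracy: write `ρ = ∑ b b*` and `E = ∑ c c*`. Then `tr (ρ E) = ∑ |⟨b, c⟩|²`, and compression
replaces the vectors by their images under `G`. A chi-square tail bound (`measure_normSq_deviation`)
and polarization (`measure_not_preservesInner`) preserve each inner product up to `2 ε d ‖b‖ ‖c‖`.
Since `∑ ‖b‖² = 1` and `∑ ‖c‖² = tr E`, the errors add up to a multiple of `ε tr E`. The last
outcome inherits the sum of the other errors, and `tr (I - E_Z)` is the sum of their traces.

Positivity of the last effect: one needs `G S Gᵀ ≤ d (1 + 18 ε)` for `S = ∑_{z < Z} E_z`. The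
eigenvectors of `S` are cut into blocks of at most `j* + (1/b) ln (8/ε)` vectors, such that the
eigenvalues in block `m` are at most `(ε/8)^m` (`eigenvalues_le_pow`). A net argument
(`measure_norm_sq_realLin_le`) bounds the squared norm of `G` on each block by `(1 + 16 ε) d`, and a
geometric series adds up the blocks (`compress_quadratic_form_le`).

A union bound (`failure_bound`) matches the two lower bounds on `d`. The vectors `b`, `c` and the
blocks occur only in the analysis: the program samples `G` and multiplies matrices, without
diagonalizing anything. Its output equals the compressed model for every random input
(`compressProg_output`), and its running time is read off its syntax, because all loop bounds are at
most input sizes (`Prog.steps_run_le`). Existence follows since failure is not certain. -/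

/-- The `d × D` matrix filled row by row with the first `d * D` terms of a sequence. -/
def sourceMatrix (d D : ℕ) (ω : ℕ → ℝ) : Matrix (Fin d) (Fin D) ℝ :=
  Matrix.of fun i k => ω (i * D + k)

instance : IsProbabilityMeasure RealRAM.gaussianSource := by
  unfold RealRAM.gaussianSource; infer_instance

lemma iIndepFun_source : iIndepFun (fun n (ω : ℕ → ℝ) => ω n) RealRAM.gaussianSource :=
  iIndepFun_infinitePi (P := fun _ : ℕ => gaussianReal 0 1) (X := fun _ x => x)
    (fun _ => measurable_id)

lemma map_source (n : ℕ) :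
    RealRAM.gaussianSource.map (fun ω : ℕ → ℝ => ω n) = gaussianReal 0 1 := by
  unfold RealRAM.gaussianSource
  exact Measure.infinitePi_map_eval (fun _ : ℕ => gaussianReal 0 1) n

/-- Independent centred Gaussians add up to a Gaussian and their variances add. For a unit vector
`u` the sum is therefore standard, which is the rotation invariance behind all that follows. -/
lemma map_sum_source {ι : Type*} (f : ι → ℕ) (hf : f.Injective) (u : ι → ℝ) (s : Finset ι) :
    RealRAM.gaussianSource.map (fun ω => ∑ k ∈ s, u k * ω (f k)) =
      gaussianReal 0 (∑ k ∈ s, ‖u k‖₊ ^ 2) := by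
  classical
  have hind : iIndepFun (fun k (ω : ℕ → ℝ) => u k * ω (f k)) RealRAM.gaussianSource :=
    (iIndepFun_source.precomp hf).comp (fun k x => u k * x) (fun k => by fun_prop)
  induction s using Finset.induction_on with
  | empty => simp
  | insert a s ha ih =>
    have h1 : RealRAM.gaussianSource.map (fun ω : ℕ → ℝ => u a * ω (f a)) =
        gaussianReal 0 (‖u a‖₊ ^ 2) := by
      rw [show (fun ω : ℕ → ℝ => u a * ω (f a)) = (fun x => u a * x) ∘ (fun ω => ω (f a)) from rfl,
        ← Measure.map_map (by fun_prop) (by fun_prop), map_source, gaussianReal_map_const_mul]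
      congr 1
      · simp
      · ext; simp
    have h2 := hind.indepFun_finsetSum_of_notMem (fun k => by fun_prop) ha
    have h3 : (∑ j ∈ s, fun ω : ℕ → ℝ => u j * ω (f j)) = fun ω => ∑ j ∈ s, u j * ω (f j) := by
      ext; simp
    rw [h3] at h2
    have h4 := gaussianReal_add_gaussianReal_of_indepFun h2 ih h1
    rw [Finset.sum_insert ha, add_comm (‖u a‖₊ ^ 2)]
    rw [add_zero] at h4
    rw [← h4]
    congr 1
    ext ω
    simp [Finset.sum_insert ha, add_comm]

lemma rowIndex_injective (d D : ℕ) :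
    Function.Injective (fun p : (_ : Fin d) × Fin D => (p.1 : ℕ) * D + p.2) := by
  rintro ⟨i, k⟩ ⟨j, l⟩ h
  have hD : 0 < D := k.pos
  have h1 : (i : ℕ) = j := by
    have := congrArg (· / D) h
    simpa [Nat.add_div_of_dvd_right, Nat.mul_add_div, mul_comm _ D, hD, Nat.div_eq_of_lt] using this
  have h2 : (k : ℕ) = l := by simpa [h1] using h
  simp [Fin.ext_iff, h1, h2]

/-- Different rows read disjoint sets of terms of the sequence, so currying turns the joint law into
the product of the row laws. -/
lemma iIndepFun_rows (d D : ℕ) :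
    iIndepFun (fun (i : Fin d) (ω : ℕ → ℝ) (k : Fin D) => ω (i * D + k))
      RealRAM.gaussianSource := by
  rw [iIndepFun_iff_map_fun_eq_infinitePi_map (by fun_prop)]
  have h1 := Measure.map_infinitePi_infinitePi_of_inj (P := fun _ : ℕ => gaussianReal 0 1)
    (rowIndex_injective d D)
  have h2 := Measure.infinitePi_map_piCurry (X := fun (_ : Fin d) (_ : Fin D) => ℝ)
    (fun (_ : Fin d) (_ : Fin D) => gaussianReal 0 1)
  rw [← h1, Measure.map_map (by fun_prop) (by fun_prop)] at h2
  have h3 : (fun (ω : ℕ → ℝ) (i : Fin d) (k : Fin D) => ω (i * D + k)) =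
    (MeasurableEquiv.piCurry fun (_ : Fin d) (_ : Fin D) => ℝ) ∘
      (fun (ω : ℕ → ℝ) (p : (_ : Fin d) × Fin D) => ω (p.1 * D + p.2)) := by
    ext; simp [Sigma.curry]
  unfold RealRAM.gaussianSource
  rw [h3, h2]
  congr 1
  ext1 i
  have h4 := Measure.map_infinitePi_infinitePi_of_inj (P := fun _ : ℕ => gaussianReal 0 1)
    (f := fun k : Fin D => (i : ℕ) * D + k) (fun k l h => by simpa [Fin.ext_iff] using h)
  rw [← h4]

/-- The Gaussian density times `exp (t x²)` is again a Gaussian function, with `1/2 - t` in place of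
`1/2`. -/
lemma mgf_sq_gaussianReal {t : ℝ} (ht : t < 1 / 2) :
    Integrable (fun x => Real.exp (t * x ^ 2)) (gaussianReal 0 1) ∧
      ∫ x, Real.exp (t * x ^ 2) ∂gaussianReal 0 1 = (√(1 - 2 * t))⁻¹ := by
  have hpos : 0 < 1 / 2 - t := by linarith
  have hfun : (fun x => gaussianPDFReal 0 1 x * Real.exp (t * x ^ 2)) =
      fun x => (√(2 * Real.pi))⁻¹ * Real.exp (-(1 / 2 - t) * x ^ 2) := by
    ext x
    simp only [gaussianPDFReal, NNReal.coe_one, mul_one, sub_zero]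
    rw [mul_assoc, ← Real.exp_add]
    congr 2
    ring
  constructor
  · rw [gaussianReal_of_var_ne_zero _ one_ne_zero,
      integrable_withDensity_iff (measurable_gaussianPDF 0 1)
        (Filter.Eventually.of_forall fun x => gaussianPDF_lt_top)]
    simp only [toReal_gaussianPDF]
    simp_rw [mul_comm (Real.exp _)]
    rw [hfun]
    exact (integrable_exp_neg_mul_sq hpos).const_mul _
  · rw [integral_gaussianReal_eq_integral_smul one_ne_zero]
    simp only [smul_eq_mul]
    rw [hfun, integral_const_mul, integral_gaussian, ← Real.sqrt_inv, ← Real.sqrt_mul (by positivity),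
      ← Real.sqrt_inv]
    congr 1
    have : 1 - 2 * t ≠ 0 := by linarith
    have h2 : (1 / 2 - t) ≠ 0 := hpos.ne'
    field_simp

/-- First-order expansion of the logarithm: with `|2 t| ≤ 1/2` the remainder of `log (1 - 2 t)` is
at most `(2 t)² / (1 - |2 t|) ≤ 8 t²`, and the square root halves it. -/
lemma inv_sqrt_one_sub_le {t : ℝ} (ht : |t| ≤ 1 / 4) :
    (√(1 - 2 * t))⁻¹ ≤ Real.exp (t + 4 * t ^ 2) := by
  have h0 : |2 * t| ≤ 1 / 2 := by rw [abs_mul, abs_two]; linarith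
  have h1 := Real.abs_log_sub_add_sum_range_le (x := 2 * t) (by linarith) 1
  simp only [Finset.sum_range_one, Nat.cast_zero, zero_add, pow_one, div_one] at h1
  have h3 : |2 * t| ^ (1 + 1) / (1 - |2 * t|) ≤ 8 * t ^ 2 := by
    rw [div_le_iff₀ (by linarith), show 1 + 1 = 2 from rfl, sq_abs]
    nlinarith [sq_nonneg t]
  have h4 := (abs_le.1 (h1.trans h3)).1
  have hpos : 0 < 1 - 2 * t := by linarith [abs_le.1 ht]
  rw [← Real.sqrt_inv, Real.sqrt_le_left (Real.exp_pos _).le, ← Real.exp_nat_mul]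
  rw [← Real.exp_log hpos, ← Real.exp_neg]
  apply Real.exp_le_exp.2
  push_cast
  linarith

lemma mgf_sq_row (d D : ℕ) (u : Fin D → ℝ) (hu : ∑ k, u k ^ 2 = 1) {t : ℝ} (ht : |t| ≤ 1 / 4)
    (i : Fin d) :
    Integrable (fun ω => Real.exp (t * (∑ k : Fin D, u k * ω (i * D + k)) ^ 2))
        RealRAM.gaussianSource ∧
      mgf (fun ω => (∑ k : Fin D, u k * ω (i * D + k)) ^ 2) RealRAM.gaussianSource t
        ≤ Real.exp (t + 4 * t ^ 2) := by
  have hlaw := map_sum_source (f := fun k : Fin D => (i : ℕ) * D + k)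
    (fun k l h => by simpa [Fin.ext_iff] using h) u Finset.univ
  have hv : ∑ k, ‖u k‖₊ ^ 2 = 1 := by
    ext; simpa using hu
  rw [hv] at hlaw
  obtain ⟨h1, h2⟩ := mgf_sq_gaussianReal (t := t) (by linarith [abs_le.1 ht])
  have hm : Measurable (fun ω : ℕ → ℝ => ∑ k : Fin D, u k * ω (i * D + k)) := by fun_prop
  constructor
  · rw [← hlaw] at h1
    exact (integrable_map_measure (by fun_prop) hm.aemeasurable).1 h1
  · have h3 := integral_map (μ := RealRAM.gaussianSource) hm.aemeasurable
      (f := fun x : ℝ => Real.exp (t * x ^ 2)) (by fun_prop)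
    rw [hlaw, h2] at h3
    rw [mgf, ← h3]
    exact inv_sqrt_one_sub_le ht

lemma mgf_sum_sq_rows (d D : ℕ) (u : Fin D → ℝ) (hu : ∑ k, u k ^ 2 = 1) {t : ℝ}
    (ht : |t| ≤ 1 / 4) :
    Integrable (fun ω => Real.exp (t * ∑ i : Fin d, (∑ k : Fin D, u k * ω (i * D + k)) ^ 2))
        RealRAM.gaussianSource ∧
      mgf (fun ω => ∑ i : Fin d, (∑ k : Fin D, u k * ω (i * D + k)) ^ 2)
        RealRAM.gaussianSource t ≤ Real.exp (d * (t + 4 * t ^ 2)) := by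
  have hind : iIndepFun (fun (i : Fin d) (ω : ℕ → ℝ) => (∑ k : Fin D, u k * ω (i * D + k)) ^ 2)
      RealRAM.gaussianSource :=
    (iIndepFun_rows d D).comp (fun _ x => (∑ k : Fin D, u k * x k) ^ 2) (fun _ => by fun_prop)
  have hm : ∀ i : Fin d, Measurable (fun (ω : ℕ → ℝ) => (∑ k : Fin D, u k * ω (i * D + k)) ^ 2) :=
    fun i => by fun_prop
  have hs : (∑ i : Fin d, fun ω : ℕ → ℝ => (∑ k : Fin D, u k * ω (i * D + k)) ^ 2) =
      fun ω => ∑ i : Fin d, (∑ k : Fin D, u k * ω (i * D + k)) ^ 2 := by ext; simp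
  constructor
  · have := hind.integrable_exp_mul_sum (t := t) hm (s := Finset.univ)
      (fun i _ => (mgf_sq_row d D u hu ht i).1)
    rw [hs] at this
    exact this
  · have := hind.mgf_sum (t := t) hm Finset.univ
    rw [hs] at this
    rw [this]
    calc _ ≤ ∏ i : Fin d, Real.exp (t + 4 * t ^ 2) :=
          Finset.prod_le_prod (fun _ _ => mgf_nonneg) (fun i _ => (mgf_sq_row d D u hu ht i).2)
      _ = _ := by rw [Finset.prod_const, Finset.card_univ, Fintype.card_fin, ← Real.exp_nat_mul]

/-- Johnson-Lindenstrauss concentration for a real unit vector. -/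
lemma measure_normSq_deviation_unit (d D : ℕ) (u : Fin D → ℝ) (hu : ∑ k, u k ^ 2 = 1) {η : ℝ}
    (h0 : 0 ≤ η) (h1 : η ≤ 1) :
    RealRAM.gaussianSource.real
        {ω | η * d ≤ |∑ i : Fin d, (∑ k : Fin D, u k * ω (i * D + k)) ^ 2 - d|}
      ≤ 2 * Real.exp (-(d * η ^ 2 / 16)) := by
  set S : (ℕ → ℝ) → ℝ := fun ω => ∑ i : Fin d, (∑ k : Fin D, u k * ω (i * D + k)) ^ 2 with hS
  -- Chernoff bound on both sides. The exponent is `d (-η t + 4 t²)`, smallest at `t = η / 8`, with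
  -- the value `-d η² / 16`; the lower tail uses `-t`.
  have ht : |η / 8| ≤ 1 / 4 := by rw [abs_of_nonneg (by positivity)]; linarith
  have ht' : |-(η / 8)| ≤ 1 / 4 := by rwa [abs_neg]
  have hup := measure_ge_le_exp_mul_mgf (μ := RealRAM.gaussianSource) (X := S) (t := η / 8)
    ((1 + η) * d) (by positivity) (mgf_sum_sq_rows d D u hu ht).1
  have hlo := measure_le_le_exp_mul_mgf (μ := RealRAM.gaussianSource) (X := S) (t := -(η / 8))
    ((1 - η) * d) (by linarith) (mgf_sum_sq_rows d D u hu ht').1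
  have hsub : {ω | η * d ≤ |S ω - d|} ⊆ {ω | (1 + η) * d ≤ S ω} ∪ {ω | S ω ≤ (1 - η) * d} := by
    intro ω hω
    rcases le_abs.1 (show η * d ≤ |S ω - d| from hω) with h | h
    · left; show (1 + η) * d ≤ S ω; linarith
    · right; show S ω ≤ (1 - η) * d; linarith
  have e1 : Real.exp (-(η / 8) * ((1 + η) * d)) * mgf S RealRAM.gaussianSource (η / 8) ≤
      Real.exp (-(d * η ^ 2 / 16)) := by
    refine (mul_le_mul_of_nonneg_left (mgf_sum_sq_rows d D u hu ht).2 (Real.exp_pos _).le).trans ?_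
    rw [← Real.exp_add]
    exact Real.exp_le_exp.2 (le_of_eq (by ring))
  have e2 : Real.exp (-(-(η / 8)) * ((1 - η) * d)) * mgf S RealRAM.gaussianSource (-(η / 8)) ≤
      Real.exp (-(d * η ^ 2 / 16)) := by
    refine (mul_le_mul_of_nonneg_left (mgf_sum_sq_rows d D u hu ht').2 (Real.exp_pos _).le).trans ?_
    rw [← Real.exp_add]
    exact Real.exp_le_exp.2 (le_of_eq (by ring))
  calc _ ≤ _ := measureReal_mono hsub
    _ ≤ _ := measureReal_union_le _ _
    _ ≤ _ := by linarith

/-- Homogeneity reduces to unit vectors. The strict inequality makes the bad event empty for `u =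
0`. -/
lemma measure_normSq_deviation (d D : ℕ) (u : Fin D → ℝ) {η : ℝ} (h0 : 0 ≤ η) (h1 : η ≤ 1) :
    RealRAM.gaussianSource.real
        {ω | η * d * ∑ k, u k ^ 2 <
          |∑ i : Fin d, (∑ k : Fin D, u k * ω (i * D + k)) ^ 2 - d * ∑ k, u k ^ 2|}
      ≤ 2 * Real.exp (-(d * η ^ 2 / 16)) := by
  rcases (Finset.sum_nonneg fun k (_ : k ∈ Finset.univ) => sq_nonneg (u k)).eq_or_lt with h | h
  · have hz : ∀ k, u k = 0 := fun k => by
      have := (Finset.sum_eq_zero_iff_of_nonneg (fun k _ => sq_nonneg (u k))).1 h.symm k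
        (Finset.mem_univ k)
      simpa using this
    simp [hz]
    positivity
  · set c := ∑ k, u k ^ 2 with hc
    have hsq : √c ^ 2 = c := Real.sq_sqrt h.le
    have hsp : 0 < √c := Real.sqrt_pos.2 h
    refine le_trans (measureReal_mono ?_)
      (measure_normSq_deviation_unit d D (fun k => u k / √c) ?_ h0 h1)
    · intro ω hω
      simp only [Set.mem_ofPred_eq] at hω ⊢
      have : ∀ i : Fin d, (∑ k : Fin D, u k / √c * ω (i * D + k)) ^ 2 =
          (∑ k : Fin D, u k * ω (i * D + k)) ^ 2 / c := by
        intro i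
        rw [← hsq, ← div_pow, Finset.sum_div]
        congr 2
        ext k; rw [hsq]; ring
      simp_rw [this]
      rw [← Finset.sum_div]
      have e : (∑ i : Fin d, (∑ k : Fin D, u k * ω (i * D + k)) ^ 2) / c - d =
        (∑ i : Fin d, (∑ k : Fin D, u k * ω (i * D + k)) ^ 2 - d * c) / c := by
        field_simp
      rw [e, abs_div, abs_of_pos h, le_div_iff₀ h]
      exact hω.le
    · simp_rw [div_pow, hsq]
      rw [← Finset.sum_div]
      exact div_self h.ne'

/-! ### Approximate preservation of complex inner products -/

/-- A real matrix as a linear map between complex Euclidean spaces. -/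
def realLin {d D : ℕ} (G : Matrix (Fin d) (Fin D) ℝ) :
    EuclideanSpace ℂ (Fin D) →ₗ[ℂ] EuclideanSpace ℂ (Fin d) :=
  Matrix.toEuclideanLin (G.map Complex.ofReal)

lemma realLin_apply {d D : ℕ} (G : Matrix (Fin d) (Fin D) ℝ) (w : EuclideanSpace ℂ (Fin D))
    (i : Fin d) : realLin G w i = ∑ k, (G i k : ℂ) * w k := by
  simp [realLin, Matrix.toLpLin_apply, Matrix.mulVec, dotProduct]

lemma norm_sq_realLin {d D : ℕ} (G : Matrix (Fin d) (Fin D) ℝ) (w : EuclideanSpace ℂ (Fin D)) :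
    ‖realLin G w‖ ^ 2 = ∑ i, (∑ k, (w k).re * G i k) ^ 2 + ∑ i, (∑ k, (w k).im * G i k) ^ 2 := by
  rw [EuclideanSpace.norm_sq_eq, ← Finset.sum_add_distrib]
  refine Finset.sum_congr rfl fun i _ => ?_
  rw [realLin_apply, ← Complex.normSq_eq_norm_sq, Complex.normSq_apply, Complex.re_sum,
    Complex.im_sum]
  simp only [Complex.re_ofReal_mul, Complex.im_ofReal_mul, mul_comm (G i _)]
  ring

lemma norm_sq_eq_re_im {D : ℕ} (w : EuclideanSpace ℂ (Fin D)) :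
    ‖w‖ ^ 2 = ∑ k, (w k).re ^ 2 + ∑ k, (w k).im ^ 2 := by
  rw [EuclideanSpace.norm_sq_eq, ← Finset.sum_add_distrib]
  refine Finset.sum_congr rfl fun i _ => ?_
  rw [← Complex.normSq_eq_norm_sq, Complex.normSq_apply]
  ring

/-- `G / √d` preserves the squared norm of `w` up to the relative error `η`. -/
def PreservesNorm {d D : ℕ} (η : ℝ) (G : Matrix (Fin d) (Fin D) ℝ)
    (w : EuclideanSpace ℂ (Fin D)) : Prop :=
  |‖realLin G w‖ ^ 2 - d * ‖w‖ ^ 2| ≤ η * d * ‖w‖ ^ 2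

/-- `G / √d` preserves the inner product of `u` and `v` up to the relative error `2 η`. -/
def PreservesInner {d D : ℕ} (η : ℝ) (G : Matrix (Fin d) (Fin D) ℝ)
    (u v : EuclideanSpace ℂ (Fin D)) : Prop :=
  ‖inner ℂ (realLin G u) (realLin G v) - d * inner ℂ u v‖ ≤ 2 * η * d * (‖u‖ * ‖v‖)

/-- As `G` is real, it acts separately on the real and the imaginary part of `w`; the bound for each
fails with probability at most `2 exp (-d η² / 16)`. -/
lemma measure_not_preservesNorm (d : ℕ) {D : ℕ} (w : EuclideanSpace ℂ (Fin D)) {η : ℝ}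
    (h0 : 0 ≤ η) (h1 : η ≤ 1) :
    RealRAM.gaussianSource.real {ω | ¬ PreservesNorm η (sourceMatrix d D ω) w}
      ≤ 4 * Real.exp (-(d * η ^ 2 / 16)) := by
  have hr := measure_normSq_deviation d D (fun k => (w k).re) h0 h1
  have hi := measure_normSq_deviation d D (fun k => (w k).im) h0 h1
  refine (measureReal_mono ?_).trans ((measureReal_union_le _ _).trans
    ((add_le_add hr hi).trans (by linarith)))
  intro ω hω
  by_contra hcon
  simp only [Set.mem_union, Set.mem_ofPred_eq, not_or, not_lt] at hcon
  apply hω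
  unfold PreservesNorm
  rw [norm_sq_realLin, norm_sq_eq_re_im]
  simp only [sourceMatrix, Matrix.of_apply]
  have h1 := abs_le.1 hcon.1
  have h2 := abs_le.1 hcon.2
  rw [abs_le]
  constructor <;> linarith

/-- Polarization. By the parallelogram law the two squared norms for the real part add up to `4`, so
its error is at most `4 η d / 4`; the imaginary part contributes the same, whence the factor `2`. -/
lemma preservesInner_of_preservesNorm_of_norm_eq_one {d D : ℕ} {η : ℝ}
    {G : Matrix (Fin d) (Fin D) ℝ} {u v : EuclideanSpace ℂ (Fin D)} (hu : ‖u‖ = 1) (hv : ‖v‖ = 1)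
    (h1 : PreservesNorm η G (u + v)) (h2 : PreservesNorm η G (u - v))
    (h3 : PreservesNorm η G (u - Complex.I • v)) (h4 : PreservesNorm η G (u + Complex.I • v)) :
    PreservesInner η G u v := by
  have p1 := parallelogram_law_with_norm ℂ u v
  have p2 := parallelogram_law_with_norm ℂ u (Complex.I • v)
  rw [norm_smul, Complex.norm_I, one_mul] at p2
  rw [hu, hv] at p1 p2
  unfold PreservesNorm at h1 h2 h3 h4
  simp only [map_add, map_sub, map_smul] at h1 h2 h3 h4
  unfold PreservesInner
  rw [inner_eq_sum_norm_sq_div_four (realLin G u), inner_eq_sum_norm_sq_div_four u, hu, hv]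
  simp only [RCLike.I_to_complex]
  set a := ‖realLin G u + realLin G v‖
  set b := ‖realLin G u - realLin G v‖
  set c := ‖realLin G u - Complex.I • realLin G v‖
  set e := ‖realLin G u + Complex.I • realLin G v‖
  set a' := ‖u + v‖
  set b' := ‖u - v‖
  set c' := ‖u - Complex.I • v‖
  set e' := ‖u + Complex.I • v‖
  have key : ((a : ℂ) ^ 2 - (b : ℂ) ^ 2 + ((c : ℂ) ^ 2 - (e : ℂ) ^ 2) * Complex.I) / 4 -
      (d : ℂ) * (((a' : ℂ) ^ 2 - (b' : ℂ) ^ 2 + ((c' : ℂ) ^ 2 - (e' : ℂ) ^ 2) * Complex.I) / 4) =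
      (((a ^ 2 - d * a' ^ 2) - (b ^ 2 - d * b' ^ 2)) / 4 : ℝ) +
      (((c ^ 2 - d * c' ^ 2) - (e ^ 2 - d * e' ^ 2)) / 4 : ℝ) * Complex.I := by
    push_cast; ring
  refine (congrArg norm key).le.trans ((norm_add_le _ _).trans ?_)
  rw [norm_mul, Complex.norm_I, mul_one, Complex.norm_real, Complex.norm_real, Real.norm_eq_abs,
    Real.norm_eq_abs]
  have q1 : |((a ^ 2 - d * a' ^ 2) - (b ^ 2 - d * b' ^ 2)) / 4| ≤ η * d := by
    have := abs_sub (a ^ 2 - d * a' ^ 2) (b ^ 2 - d * b' ^ 2)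
    rw [abs_div, abs_of_pos (show (0 : ℝ) < 4 by norm_num), div_le_iff₀ (by norm_num)]
    have e1 : η * d * a' ^ 2 + η * d * b' ^ 2 = η * d * 4 := by
      rw [← mul_add]; congr 1; linarith
    linarith
  have q2 : |((c ^ 2 - d * c' ^ 2) - (e ^ 2 - d * e' ^ 2)) / 4| ≤ η * d := by
    have := abs_sub (c ^ 2 - d * c' ^ 2) (e ^ 2 - d * e' ^ 2)
    rw [abs_div, abs_of_pos (show (0 : ℝ) < 4 by norm_num), div_le_iff₀ (by norm_num)]
    have e1 : η * d * c' ^ 2 + η * d * e' ^ 2 = η * d * 4 := by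
      rw [← mul_add]; congr 1; linarith
    linarith
  linarith

lemma PreservesInner.smul {d D : ℕ} {η : ℝ} {G : Matrix (Fin d) (Fin D) ℝ}
    {u v : EuclideanSpace ℂ (Fin D)} (h : PreservesInner η G u v) (a b : ℂ) :
    PreservesInner η G (a • u) (b • v) := by
  unfold PreservesInner at h ⊢
  have e : inner ℂ (realLin G (a • u)) (realLin G (b • v)) - d * inner ℂ (a • u) (b • v) =
      (starRingEnd ℂ) a * b * (inner ℂ (realLin G u) (realLin G v) - d * inner ℂ u v) := by
    simp only [map_smul, inner_smul_left, inner_smul_right]; ring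
  rw [e, norm_mul, norm_mul, RCLike.norm_conj, norm_smul, norm_smul]
  calc _ ≤ ‖a‖ * ‖b‖ * _ := mul_le_mul_of_nonneg_left h (by positivity)
    _ = _ := by ring

/-- The vectors are normalized before polarizing, so that the error scales with `‖u‖ ‖v‖` and not
with `‖u‖² + ‖v‖²`. Four norms at cost `4` each give `16`. -/
lemma measure_not_preservesInner (d : ℕ) {D : ℕ} (u v : EuclideanSpace ℂ (Fin D)) {η : ℝ}
    (h0 : 0 ≤ η) (h1 : η ≤ 1) :
    RealRAM.gaussianSource.real {ω | ¬ PreservesInner η (sourceMatrix d D ω) u v}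
      ≤ 16 * Real.exp (-(d * η ^ 2 / 16)) := by
  rcases eq_or_ne u 0 with rfl | hu
  · simp [PreservesInner]; positivity
  rcases eq_or_ne v 0 with rfl | hv
  · simp [PreservesInner]; positivity
  have hun : (‖u‖ : ℂ) ≠ 0 := by simpa using hu
  have hvn : (‖v‖ : ℂ) ≠ 0 := by simpa using hv
  set u' : EuclideanSpace ℂ (Fin D) := (‖u‖ : ℂ)⁻¹ • u with hu'
  set v' : EuclideanSpace ℂ (Fin D) := (‖v‖ : ℂ)⁻¹ • v with hv'
  have nu : ‖u'‖ = 1 := by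
    rw [hu', norm_smul, norm_inv, Complex.norm_real, norm_norm]
    exact inv_mul_cancel₀ (by simpa using hu)
  have nv : ‖v'‖ = 1 := by
    rw [hv', norm_smul, norm_inv, Complex.norm_real, norm_norm]
    exact inv_mul_cancel₀ (by simpa using hv)
  have b1 := measure_not_preservesNorm d (u' + v') h0 h1
  have b2 := measure_not_preservesNorm d (u' - v') h0 h1
  have b3 := measure_not_preservesNorm d (u' - Complex.I • v') h0 h1
  have b4 := measure_not_preservesNorm d (u' + Complex.I • v') h0 h1
  have hsub : {ω | ¬ PreservesInner η (sourceMatrix d D ω) u v} ⊆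
      ({ω | ¬ PreservesNorm η (sourceMatrix d D ω) (u' + v')} ∪
        {ω | ¬ PreservesNorm η (sourceMatrix d D ω) (u' - v')}) ∪
      ({ω | ¬ PreservesNorm η (sourceMatrix d D ω) (u' - Complex.I • v')} ∪
        {ω | ¬ PreservesNorm η (sourceMatrix d D ω) (u' + Complex.I • v')}) := by
    intro ω hω
    by_contra hcon
    simp only [Set.mem_union, Set.mem_ofPred_eq, not_or, not_not] at hcon
    apply hω
    have := (preservesInner_of_preservesNorm_of_norm_eq_one nu nv hcon.1.1 hcon.1.2 hcon.2.1
      hcon.2.2).smul (‖u‖ : ℂ) (‖v‖ : ℂ)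
    simpa only [hu', hv', smul_inv_smul₀ hun, smul_inv_smul₀ hvn] using this
  refine (measureReal_mono hsub).trans ((measureReal_union_le _ _).trans ?_)
  have c1 := measureReal_union_le (μ := RealRAM.gaussianSource)
    {ω | ¬ PreservesNorm η (sourceMatrix d D ω) (u' + v')}
    {ω | ¬ PreservesNorm η (sourceMatrix d D ω) (u' - v')}
  have c2 := measureReal_union_le (μ := RealRAM.gaussianSource)
    {ω | ¬ PreservesNorm η (sourceMatrix d D ω) (u' - Complex.I • v')}
    {ω | ¬ PreservesNorm η (sourceMatrix d D ω) (u' + Complex.I • v')}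
  linarith

/-! ### Nets and the norm of a Gaussian matrix on a subspace -/

/-- The unit ball of an `n`-dimensional space has a `1/2`-net with at most `5 ^ n` elements. -/
lemma exists_half_net (V : Type*) [NormedAddCommGroup V] [NormedSpace ℝ V]
    [FiniteDimensional ℝ V] :
    ∃ s : Finset V, s.card ≤ 5 ^ Module.finrank ℝ V ∧ (∀ y ∈ s, ‖y‖ ≤ 1) ∧
      ∀ x : V, ‖x‖ ≤ 1 → ∃ y ∈ s, ‖x - y‖ ≤ 1 / 2 := by
  classical
  let P : Finset V → Prop := fun s => (∀ y ∈ s, ‖y‖ ≤ 1) ∧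
    ∀ y ∈ s, ∀ z ∈ s, y ≠ z → 1 / 2 ≤ ‖y - z‖
  have hcard : ∀ s, P s → s.card ≤ 5 ^ Module.finrank ℝ V := by
    intro s hs
    -- Scaling by `2` produces a `1`-separated set in the ball of radius `2`, the situation of
    -- `Besicovitch.card_le_of_separated`.
    have hinj : Function.Injective (fun y : V => (2 : ℝ) • y) :=
      smul_right_injective V (two_ne_zero)
    rw [← Finset.card_image_of_injective s hinj]
    apply Besicovitch.card_le_of_separated
    · intro c hc
      obtain ⟨y, hy, rfl⟩ := Finset.mem_image.1 hc
      rw [norm_smul, Real.norm_two]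
      linarith [hs.1 y hy]
    · intro c hc e he hne
      obtain ⟨y, hy, rfl⟩ := Finset.mem_image.1 hc
      obtain ⟨z, hz, rfl⟩ := Finset.mem_image.1 he
      rw [← smul_sub, norm_smul, Real.norm_two]
      linarith [hs.2 y hy z hz (fun h => hne (by rw [h]))]
  let Q : ℕ → Prop := fun n => ∃ s, P s ∧ s.card = n
  have hQ0 : Q 0 := ⟨∅, ⟨by simp, by simp⟩, rfl⟩
  -- A separated set of maximal cardinality is a net: a point far from all of it could be added.
  obtain ⟨s, hs, hsc⟩ := Nat.findGreatest_spec (P := Q) (Nat.zero_le (5 ^ Module.finrank ℝ V)) hQ0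
  refine ⟨s, hcard s hs, hs.1, fun x hx => ?_⟩
  by_contra! hcon
  have hxs : x ∉ s := fun h => by
    have := hcon x h
    simp at this
    linarith
  have hP : P (insert x s) := by
    constructor
    · intro y hy
      rcases Finset.mem_insert.1 hy with rfl | hy
      · exact hx
      · exact hs.1 y hy
    · intro y hy z hz hne
      rcases Finset.mem_insert.1 hy with rfl | hy' <;> rcases Finset.mem_insert.1 hz with rfl | hz'
      · exact absurd rfl hne
      · exact (hcon z hz').le
      · rw [norm_sub_rev]; exact (hcon y hy').le
      · exact hs.2 y hy' z hz' hne
  have := Nat.le_findGreatest (P := Q) (hcard _ hP) ⟨_, hP, rfl⟩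
  rw [Finset.card_insert_of_notMem hxs, hsc] at this
  omega

/-- Approximating a unit vector by a net point gives `‖f‖ ≤ M + ‖f‖ / 2`, and the last term is
absorbed. -/
lemma norm_le_of_half_net {V : Type*} [NormedAddCommGroup V] [NormedSpace ℂ V]
    [FiniteDimensional ℂ V] {s : Finset V}
    (hnet : ∀ x : V, ‖x‖ ≤ 1 → ∃ y ∈ s, ‖x - y‖ ≤ 1 / 2) (g : V →ₗ[ℂ] ℂ) {M : ℝ}
    (hg : ∀ y ∈ s, ‖g y‖ ≤ M) (x : V) : ‖g x‖ ≤ 2 * M * ‖x‖ := by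
  set f : V →L[ℂ] ℂ := LinearMap.toContinuousLinearMap g with hf
  have hfg : ∀ x, f x = g x := fun x => rfl
  have h0 : 0 ≤ M := by
    obtain ⟨y, hy, -⟩ := hnet 0 (by simp)
    exact (norm_nonneg _).trans (hg y hy)
  have hb : ‖f‖ ≤ M + ‖f‖ / 2 := by
    refine ContinuousLinearMap.opNorm_le_of_unit_norm (𝕜 := ℂ) (by positivity) fun z hz => ?_
    obtain ⟨y, hy, hzy⟩ := hnet z hz.le
    have : f z = g y + f (z - y) := by rw [map_sub, hfg y]; ring
    rw [this]
    refine (norm_add_le _ _).trans (add_le_add (hg y hy) ((f.le_opNorm _).trans ?_))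
    nlinarith [norm_nonneg f]
  have := f.le_opNorm x
  rw [hfg] at this
  exact this.trans (mul_le_mul_of_nonneg_right (by linarith) (norm_nonneg _))

/-- The net bound is applied to the Hermitian form `⟨G y, G z⟩ - d ⟨y, z⟩` in one argument and then,
by symmetry, in the other. Each passage doubles the constant: `2 η d` on the net, then `4 η d`, then
`8 η d`. -/
lemma norm_sq_realLin_le_of_net {d D : ℕ} {η : ℝ} {G : Matrix (Fin d) (Fin D) ℝ} (hη : 0 ≤ η)
    {V : Submodule ℂ (EuclideanSpace ℂ (Fin D))} {s : Finset V} (hs : ∀ y ∈ s, ‖y‖ ≤ 1)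
    (hnet : ∀ x : V, ‖x‖ ≤ 1 → ∃ y ∈ s, ‖x - y‖ ≤ 1 / 2)
    (hG : ∀ y ∈ s, ∀ z ∈ s, PreservesInner η G (y : EuclideanSpace ℂ (Fin D)) z)
    (a : EuclideanSpace ℂ (Fin D)) (ha : a ∈ V) :
    ‖realLin G a‖ ^ 2 ≤ (1 + 8 * η) * d * ‖a‖ ^ 2 := by
  let g : EuclideanSpace ℂ (Fin D) → V →ₗ[ℂ] ℂ := fun y =>
    { toFun := fun z => inner ℂ (realLin G y) (realLin G z) - d * inner ℂ y (z : EuclideanSpace ℂ _)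
      map_add' := fun z w => by simp; ring
      map_smul' := fun c z => by simp; ring }
  have hgs : ∀ y z : V, ‖g y z‖ = ‖g z y‖ := fun y z => by
    rw [← RCLike.norm_conj]
    simp [g]
  have h1 : ∀ y ∈ s, ∀ z : V, ‖g y z‖ ≤ 2 * (2 * η * d) * ‖z‖ := fun y hy z => by
    refine norm_le_of_half_net hnet (g y) (fun w hw => (hG y hy w hw).trans ?_) z
    have : ‖(y : EuclideanSpace ℂ (Fin D))‖ * ‖(w : EuclideanSpace ℂ (Fin D))‖ ≤ 1 :=
      mul_le_one₀ (hs y hy) (norm_nonneg _) (hs w hw)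
    exact mul_le_of_le_one_right (by positivity) this
  have h2 := norm_le_of_half_net hnet (g a) (M := 2 * (2 * η * d) * ‖a‖)
    (fun y hy => by rw [hgs ⟨a, ha⟩ y]; exact h1 y hy ⟨a, ha⟩) ⟨a, ha⟩
  have h3 : g a ⟨a, ha⟩ = ((‖realLin G a‖ ^ 2 - d * ‖a‖ ^ 2 : ℝ) : ℂ) := by
    simp [g, inner_self_eq_norm_sq_to_K]
  rw [h3, Complex.norm_real] at h2
  have h4 := (le_abs_self _).trans h2
  simp only [Submodule.coe_norm] at h4
  nlinarith

lemma measure_norm_sq_realLin_le (d : ℕ) {D r : ℕ} {η : ℝ} (h0 : 0 ≤ η) (h1 : η ≤ 1)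
    (V : Submodule ℂ (EuclideanSpace ℂ (Fin D))) (hV : Module.finrank ℂ V ≤ r) :
    RealRAM.gaussianSource.real
        {ω | ¬ ∀ a ∈ V, ‖realLin (sourceMatrix d D ω) a‖ ^ 2 ≤ (1 + 8 * η) * d * ‖a‖ ^ 2}
      ≤ 625 ^ r * (16 * Real.exp (-(d * η ^ 2 / 16))) := by
  obtain ⟨s, hcard, hs, hnet⟩ := exists_half_net V
  have hsub : {ω | ¬ ∀ a ∈ V, ‖realLin (sourceMatrix d D ω) a‖ ^ 2 ≤ (1 + 8 * η) * d * ‖a‖ ^ 2} ⊆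
      ⋃ p ∈ s ×ˢ s, {ω | ¬ PreservesInner η (sourceMatrix d D ω)
        (p.1 : EuclideanSpace ℂ (Fin D)) p.2} := by
    intro ω hω
    by_contra hcon
    simp only [Set.mem_iUnion, Set.mem_ofPred_eq, not_exists, not_not] at hcon
    exact hω fun a ha => norm_sq_realLin_le_of_net h0 hs hnet
      (fun y hy z hz => hcon (y, z) (Finset.mem_product.2 ⟨hy, hz⟩)) a ha
  refine (measureReal_mono hsub (measure_ne_top _ _)).trans
    ((measureReal_biUnion_finset_le _ _).trans ?_)
  refine (Finset.sum_le_card_nsmul _ _ _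
    (fun p _ => measure_not_preservesInner d (p.1 : EuclideanSpace ℂ (Fin D)) p.2 h0 h1)).trans ?_
  rw [nsmul_eq_mul, Finset.card_product]
  refine mul_le_mul_of_nonneg_right ?_ (by positivity)
  have h2 : s.card ≤ 25 ^ r := by
    refine hcard.trans ?_
    -- The net lives in a real space of dimension twice the complex one: `5 ^ (2 r) = 25 ^ r`
    -- points, hence `625 ^ r` pairs.
    rw [finrank_real_of_complex, pow_mul]
    exact Nat.pow_le_pow_right (by norm_num) hV
  have h3 : s.card * s.card ≤ 625 ^ r := by
    calc _ ≤ 25 ^ r * 25 ^ r := Nat.mul_le_mul h2 h2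
      _ = _ := by rw [← mul_pow]; norm_num
  exact_mod_cast h3

/-! ### Sums of rank one matrices -/

/-- The rank one matrix `u u*`. -/
def outer {n : ℕ} (u : EuclideanSpace ℂ (Fin n)) : Matrix (Fin n) (Fin n) ℂ :=
  Matrix.vecMulVec u (star (u : Fin n → ℂ))

/-- The matrix `G M Gᵀ` for a real matrix `G`. -/
def compress {d D : ℕ} (G : Matrix (Fin d) (Fin D) ℝ) (M : Matrix (Fin D) (Fin D) ℂ) :
    Matrix (Fin d) (Fin d) ℂ :=
  G.map Complex.ofReal * M * (G.map Complex.ofReal).conjTranspose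

lemma compress_sum {d D : ℕ} (G : Matrix (Fin d) (Fin D) ℝ) {ι : Type*} (s : Finset ι)
    (M : ι → Matrix (Fin D) (Fin D) ℂ) : compress G (∑ i ∈ s, M i) = ∑ i ∈ s, compress G (M i) := by
  simp only [compress, Matrix.mul_sum, Matrix.sum_mul]

lemma compress_smul {d D : ℕ} (G : Matrix (Fin d) (Fin D) ℝ) (c : ℂ)
    (M : Matrix (Fin D) (Fin D) ℂ) : compress G (c • M) = c • compress G M := by
  simp [compress]

lemma compress_posSemidef {d D : ℕ} (G : Matrix (Fin d) (Fin D) ℝ) {M : Matrix (Fin D) (Fin D) ℂ}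
    (hM : M.PosSemidef) : (compress G M).PosSemidef :=
  hM.mul_mul_conjTranspose_same _

lemma compress_outer {d D : ℕ} (G : Matrix (Fin d) (Fin D) ℝ) (u : EuclideanSpace ℂ (Fin D)) :
    compress G (outer u) = outer (realLin G u) := by
  unfold compress outer
  rw [Matrix.mul_vecMulVec, Matrix.vecMulVec_mul, ← Matrix.star_mulVec]
  rfl

lemma trace_outer {n : ℕ} (u : EuclideanSpace ℂ (Fin n)) : (outer u).trace = (‖u‖ ^ 2 : ℝ) := by
  rw [outer, Matrix.trace_vecMulVec]
  have := inner_self_eq_norm_sq_to_K (𝕜 := ℂ) u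
  rw [EuclideanSpace.inner_eq_star_dotProduct] at this
  rw [this]; simp

lemma star_dotProduct_mul_dotProduct_star {n : ℕ} (u v : EuclideanSpace ℂ (Fin n)) :
    (star (u : Fin n → ℂ) ⬝ᵥ (v : Fin n → ℂ)) * ((u : Fin n → ℂ) ⬝ᵥ star (v : Fin n → ℂ)) =
      (‖inner ℂ u v‖ ^ 2 : ℝ) := by
  rw [EuclideanSpace.inner_eq_star_dotProduct, ← Complex.normSq_eq_norm_sq,
    Complex.normSq_eq_conj_mul_self, mul_comm, dotProduct_comm (star _)]
  congr 1
  exact Matrix.dotProduct_star _ _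

lemma trace_outer_mul_outer {n : ℕ} (u v : EuclideanSpace ℂ (Fin n)) :
    (outer u * outer v).trace = (‖inner ℂ u v‖ ^ 2 : ℝ) := by
  rw [outer, outer, Matrix.vecMulVec_mul_vecMulVec, Matrix.trace_vecMulVec,
    dotProduct_smul, smul_eq_mul, star_dotProduct_mul_dotProduct_star]

lemma dotProduct_outer_mulVec {n : ℕ} (u : EuclideanSpace ℂ (Fin n)) (x : Fin n → ℂ) :
    star x ⬝ᵥ (outer u).mulVec x = (‖inner ℂ u (WithLp.toLp 2 x)‖ ^ 2 : ℝ) := by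
  rw [← star_dotProduct_mul_dotProduct_star, outer, Matrix.vecMulVec_mulVec, dotProduct_smul]
  simp [dotProduct_comm (star x), mul_comm]

lemma eq_sum_outer {n : ℕ} {M : Matrix (Fin n) (Fin n) ℂ} (hM : M.IsHermitian) :
    M = ∑ i, (hM.eigenvalues i : ℂ) • outer (hM.eigenvectorBasis i) := by
  conv_lhs => rw [hM.spectral_theorem]
  ext a b
  rw [Unitary.conjStarAlgAut_apply, Matrix.mul_assoc, Matrix.mul_apply]
  simp only [Matrix.diagonal_mul, Matrix.sum_apply, Matrix.smul_apply, outer,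
    Matrix.vecMulVec_apply, Matrix.star_eq_conjTranspose, Matrix.conjTranspose_apply,
    Matrix.IsHermitian.eigenvectorUnitary_apply, Function.comp, smul_eq_mul, Pi.star_apply]
  exact Finset.sum_congr rfl fun i _ => by simp only [RCLike.ofReal_eq_complex_ofReal]; ring

/-- The roots of the eigenvalues are absorbed into the eigenvectors. Traces then become plain sums
of squared norms and of squared inner products, the quantities that `G` nearly preserves. -/
lemma exists_eq_sum_outer {n : ℕ} {M : Matrix (Fin n) (Fin n) ℂ} (hM : M.PosSemidef) :
    ∃ b : Fin n → EuclideanSpace ℂ (Fin n), M = ∑ i, outer (b i) := by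
  refine ⟨fun i => (√(hM.1.eigenvalues i) : ℂ) • hM.1.eigenvectorBasis i, ?_⟩
  conv_lhs => rw [eq_sum_outer hM.1]
  refine Finset.sum_congr rfl fun i _ => ?_
  have h := Real.mul_self_sqrt (hM.eigenvalues_nonneg i)
  ext a b
  simp only [outer, Matrix.smul_apply, Matrix.vecMulVec_apply, Pi.star_apply, PiLp.smul_apply,
    smul_eq_mul, star_mul', RCLike.star_def, Complex.conj_ofReal]
  conv_lhs => rw [← h]
  push_cast; ring

/-! ### The compressed model -/

/-- If `G` has squared norm at most `N` on the span of the orthonormal vectors `v i`, `i ∈ B`, then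
`∑ i ∈ B, G v_i v_i* Gᵀ ≤ N`. -/
lemma sum_norm_inner_sq_le {d D : ℕ} {G : Matrix (Fin d) (Fin D) ℝ} {ι : Type*}
    {v : ι → EuclideanSpace ℂ (Fin D)} (hv : Orthonormal ℂ v) (B : Finset ι) {N : ℝ}
    (hN0 : 0 ≤ N)
    (hN : ∀ a ∈ Submodule.span ℂ (v '' B), ‖realLin G a‖ ^ 2 ≤ N * ‖a‖ ^ 2)
    (x : EuclideanSpace ℂ (Fin d)) :
    ∑ i ∈ B, ‖inner ℂ (realLin G (v i)) x‖ ^ 2 ≤ N * ‖x‖ ^ 2 := by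
  -- Duality between `G` and its adjoint: for `a = ∑ c_i v_i` both `‖a‖²` and `⟨G a, x⟩` equal the
  -- sum `q` to be bounded, so Cauchy-Schwarz gives `q² ≤ N q ‖x‖²`.
  set c : ι → ℂ := fun i => inner ℂ (realLin G (v i)) x with hc
  set a : EuclideanSpace ℂ (Fin D) := ∑ i ∈ B, c i • v i with ha
  set q : ℝ := ∑ i ∈ B, ‖c i‖ ^ 2 with hq
  have hcc : ∀ i, (starRingEnd ℂ) (c i) * c i = ((‖c i‖ ^ 2 : ℝ) : ℂ) := fun i => by
    rw [← Complex.normSq_eq_norm_sq, Complex.normSq_eq_conj_mul_self]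
  have hmem : a ∈ Submodule.span ℂ (v '' B) :=
    Submodule.sum_mem _ fun i hi => Submodule.smul_mem _ _
      (Submodule.subset_span (Set.mem_image_of_mem _ hi))
  have h1 : ‖a‖ ^ 2 = q := by
    have h := inner_self_eq_norm_sq_to_K (𝕜 := ℂ) a
    rw [ha, hv.inner_sum] at h
    simp only [hcc] at h
    rw [← ha] at h
    have h' : ((q : ℝ) : ℂ) = ((‖a‖ ^ 2 : ℝ) : ℂ) := by
      rw [hq]; push_cast; push_cast at h; exact h
    exact (Complex.ofReal_injective h').symm
  have h2 : inner ℂ (realLin G a) x = (q : ℂ) := by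
    rw [ha, map_sum, sum_inner, hq, Complex.ofReal_sum]
    refine Finset.sum_congr rfl fun i _ => ?_
    rw [map_smul, inner_smul_left, ← hcc]
  have hq0 : 0 ≤ q := Finset.sum_nonneg fun _ _ => by positivity
  have h3 : q ≤ ‖realLin G a‖ * ‖x‖ := by
    have := norm_inner_le_norm (𝕜 := ℂ) (realLin G a) x
    rwa [h2, Complex.norm_real, Real.norm_of_nonneg hq0] at this
  have h4 := hN a hmem
  rw [h1] at h4
  rcases hq0.eq_or_lt with h0 | h0
  · rw [← h0]; positivity
  · have h5 : q * q ≤ q * (N * ‖x‖ ^ 2) := by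
      calc q * q ≤ (‖realLin G a‖ * ‖x‖) * (‖realLin G a‖ * ‖x‖) :=
            mul_le_mul h3 h3 hq0 (by positivity)
        _ = ‖realLin G a‖ ^ 2 * ‖x‖ ^ 2 := by ring
        _ ≤ (N * q) * ‖x‖ ^ 2 := mul_le_mul_of_nonneg_right h4 (by positivity)
        _ = _ := by ring
    exact le_of_mul_le_mul_left h5 h0

/-- The compressed states. -/
def compressedState {X d D : ℕ} (G : Matrix (Fin d) (Fin D) ℝ)
    (ρ : Fin X → Matrix (Fin D) (Fin D) ℂ) (x : Fin X) : Matrix (Fin d) (Fin d) ℂ :=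
  (((compress G (ρ x)).trace.re⁻¹ : ℝ) : ℂ) • compress G (ρ x)

/-- The compressed effects, except for the last outcome. -/
def compressedEffect {d D : ℕ} (ε : ℝ) (G : Matrix (Fin d) (Fin D) ℝ)
    (M : Matrix (Fin D) (Fin D) ℂ) : Matrix (Fin d) (Fin d) ℂ :=
  (((d * (1 + 18 * ε))⁻¹ : ℝ) : ℂ) • compress G M

/-- The compressed measurements. -/
def compressedPOVM {K d D : ℕ} (ε : ℝ) (G : Matrix (Fin d) (Fin D) ℝ)
    (E : Fin (K + 1) → Matrix (Fin D) (Fin D) ℂ) : Fin (K + 1) → Matrix (Fin d) (Fin d) ℂ :=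
  Fin.lastCases (1 - ∑ k : Fin K, compressedEffect ε G (E k.castSucc))
    fun k => compressedEffect ε G (E k.castSucc)

lemma sum_compressedEffect {K d D : ℕ} (ε : ℝ) (G : Matrix (Fin d) (Fin D) ℝ)
    (E : Fin (K + 1) → Matrix (Fin D) (Fin D) ℂ) :
    ∑ k : Fin K, compressedEffect ε G (E k.castSucc) = compressedEffect ε G (sumButLast E) := by
  simp only [compressedEffect, sumButLast, compress_sum, Finset.smul_sum]

lemma trace_compress_sum_outer {d D n : ℕ} (G : Matrix (Fin d) (Fin D) ℝ)
    (b : Fin n → EuclideanSpace ℂ (Fin D)) :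
    (compress G (∑ i, outer (b i))).trace = ((∑ i, ‖realLin G (b i)‖ ^ 2 : ℝ) : ℂ) := by
  simp only [compress_sum, compress_outer, Matrix.trace_sum, trace_outer, Complex.ofReal_sum]

lemma trace_sum_outer_mul_sum_outer {D n m : ℕ} (b : Fin n → EuclideanSpace ℂ (Fin D))
    (c : Fin m → EuclideanSpace ℂ (Fin D)) :
    ((∑ i, outer (b i)) * ∑ j, outer (c j)).trace =
      ((∑ i, ∑ j, ‖inner ℂ (b i) (c j)‖ ^ 2 : ℝ) : ℂ) := by
  simp only [Matrix.sum_mul, Matrix.mul_sum, Matrix.trace_sum, trace_outer_mul_outer,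
    Complex.ofReal_sum]
  exact Finset.sum_comm

/-- Difference of two squares: with `p = ‖u‖ ‖v‖` the difference of the roots is at most `2 ε d p`,
and `ε ≤ 1/2` bounds their sum by `3 d p`. -/
lemma abs_norm_inner_sq_sub_le {d D : ℕ} {ε : ℝ} {G : Matrix (Fin d) (Fin D) ℝ}
    (h0 : 0 ≤ ε) (h1 : ε ≤ 1 / 2) {u v : EuclideanSpace ℂ (Fin D)} (h : PreservesInner ε G u v) :
    |‖inner ℂ (realLin G u) (realLin G v)‖ ^ 2 - d ^ 2 * ‖inner ℂ u v‖ ^ 2|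
      ≤ 6 * ε * d ^ 2 * (‖u‖ ^ 2 * ‖v‖ ^ 2) := by
  unfold PreservesInner at h
  set p := ‖u‖ * ‖v‖ with hp
  have hi := norm_inner_le_norm (𝕜 := ℂ) u v
  have hn : |‖inner ℂ (realLin G u) (realLin G v)‖ - d * ‖inner ℂ u v‖| ≤ 2 * ε * d * p := by
    refine le_trans ?_ h
    have := abs_norm_sub_norm_le (inner ℂ (realLin G u) (realLin G v)) (d * inner ℂ u v)
    simpa using this
  set a := ‖inner ℂ (realLin G u) (realLin G v)‖
  set c := ‖inner ℂ u v‖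
  have hc : 0 ≤ c := norm_nonneg _
  have hd : (0 : ℝ) ≤ d := Nat.cast_nonneg _
  have hp0 : 0 ≤ p := by positivity
  have ha : 0 ≤ a := norm_nonneg _
  have e : a ^ 2 - d ^ 2 * c ^ 2 = (a - d * c) * (a + d * c) := by ring
  have hs : a + d * c ≤ 3 * (d * p) := by
    have h2 := (abs_le.1 hn).2
    have h3 : d * c ≤ d * p := mul_le_mul_of_nonneg_left hi hd
    have h4 : 2 * ε * d * p ≤ 1 * (d * p) := by
      rw [mul_assoc]; exact mul_le_mul_of_nonneg_right (by linarith) (by positivity)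
    linarith
  rw [e, abs_mul, abs_of_nonneg (show 0 ≤ a + d * c by positivity)]
  calc _ ≤ (2 * ε * d * p) * (3 * (d * p)) :=
        mul_le_mul hn hs (by positivity) (by positivity)
    _ = _ := by rw [hp]; ring

/-- The conditions on `G` under which the compressed model has the desired properties, for states
`∑ i, outer (b x i)` and effects `∑ i, outer (c y k i)`. -/
structure IsGood {X Y K d D : ℕ} (ε : ℝ) (G : Matrix (Fin d) (Fin D) ℝ)
    (E : Fin Y → Fin (K + 1) → Matrix (Fin D) (Fin D) ℂ)
    (b : Fin X → Fin D → EuclideanSpace ℂ (Fin D))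
    (c : Fin Y → Fin K → Fin D → EuclideanSpace ℂ (Fin D)) : Prop where
  preservesNorm : ∀ x i, PreservesNorm ε G (b x i)
  preservesInner : ∀ x i y k j, PreservesInner ε G (b x i) (c y k j)
  bound : ∀ y (v : Fin d → ℂ), (star v ⬝ᵥ (compress G (sumButLast (E y))).mulVec v).re
    ≤ (1 + 18 * ε) * d * ‖WithLp.toLp 2 v‖ ^ 2

/-- Here `τ` is the normalized trace of a compressed state and `1 + 18 ε` comes from the effects.
The denominator differs from `1` by at most `28 ε`, so the numerator error is at most `(6 + 28) ε
t`, rounded up to `100 ε t`; division by at least `1/2` doubles it. -/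
lemma abs_quotient_sub_le {ε a a₀ τ t : ℝ} (h0 : 0 < ε) (h1 : ε ≤ 1 / 2) (ht : 0 ≤ t)
    (ha₀ : 0 ≤ a₀) (ha₀t : a₀ ≤ t) (ha : |a - a₀| ≤ 6 * ε * t) (hτ : |τ - 1| ≤ ε) :
    |a / (τ * (1 + 18 * ε)) - a₀| ≤ 200 * ε * t := by
  obtain ⟨hτ1, hτ2⟩ := abs_le.1 hτ
  have hτ0 : 1 / 2 ≤ τ := by linarith
  obtain ⟨ha1, ha2⟩ := abs_le.1 ha
  have hs : 1 / 2 ≤ τ * (1 + 18 * ε) := by nlinarith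
  have hsp : 0 < τ * (1 + 18 * ε) := by linarith
  have e : a / (τ * (1 + 18 * ε)) - a₀ = (a - a₀ * (τ * (1 + 18 * ε))) / (τ * (1 + 18 * ε)) := by
    field_simp
  rw [e, abs_div, abs_of_pos hsp, div_le_iff₀ hsp]
  have hb : |a - a₀ * (τ * (1 + 18 * ε))| ≤ 100 * ε * t := by
    have h3 : |τ * (1 + 18 * ε) - 1| ≤ 28 * ε := by
      rw [abs_le]; constructor <;> nlinarith
    obtain ⟨h4, h5⟩ := abs_le.1 h3
    have h6 : a₀ * (28 * ε) ≤ t * (28 * ε) := mul_le_mul_of_nonneg_right ha₀t (by positivity)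
    have h7 : a₀ * (τ * (1 + 18 * ε) - 1) ≤ a₀ * (28 * ε) := mul_le_mul_of_nonneg_left h5 ha₀
    have h8 : a₀ * (-(28 * ε)) ≤ a₀ * (τ * (1 + 18 * ε) - 1) := mul_le_mul_of_nonneg_left h4 ha₀
    have h9 : 0 ≤ ε * t := by positivity
    rw [abs_le]; constructor <;> linarith
  have h10 : 0 ≤ 200 * ε * t := by positivity
  nlinarith

/-- The deterministic half of the argument: all randomness is contained in `IsGood`. -/
theorem IsGood.isCompressedModel {X Y K d D : ℕ} {ε : ℝ} {G : Matrix (Fin d) (Fin D) ℝ}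
    {ρ : Fin X → Matrix (Fin D) (Fin D) ℂ} {E : Fin Y → Fin (K + 1) → Matrix (Fin D) (Fin D) ℂ}
    {b : Fin X → Fin D → EuclideanSpace ℂ (Fin D)}
    {c : Fin Y → Fin K → Fin D → EuclideanSpace ℂ (Fin D)}
    (hG : IsGood ε G E b c) (hd : 0 < d) (h0 : 0 < ε) (h1 : ε ≤ 1 / 2)
    (hρ : ∀ x, IsQuantumState (ρ x)) (hE : ∀ y, IsPOVM (E y))
    (hb : ∀ x, ρ x = ∑ i, outer (b x i))
    (hc : ∀ y (k : Fin K), E y k.castSucc = ∑ i, outer (c y k i)) :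
    IsCompressedModel ε ρ E (compressedState G ρ) (fun y => compressedPOVM ε G (E y)) := by
  have hd' : (0 : ℝ) < d := Nat.cast_pos.2 hd
  have hbn : ∀ x, ∑ i, ‖b x i‖ ^ 2 = 1 := fun x => by
    have h := (hρ x).trace_eq_one
    rw [hb x] at h
    simp only [Matrix.trace_sum, trace_outer] at h
    exact_mod_cast h
  set τ : Fin X → ℝ := fun x => ∑ i, ‖realLin G (b x i)‖ ^ 2 with hτ
  have htr : ∀ x, (compress G (ρ x)).trace = (τ x : ℂ) := fun x => by
    rw [hb x, trace_compress_sum_outer]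
  have hτd : ∀ x, |τ x / d - 1| ≤ ε := fun x => by
    have e : τ x / d - 1 = (∑ i, (‖realLin G (b x i)‖ ^ 2 - d * ‖b x i‖ ^ 2)) / d := by
      rw [Finset.sum_sub_distrib, ← Finset.mul_sum, hbn]; field_simp; rfl
    rw [e, abs_div, abs_of_pos hd', div_le_iff₀ hd']
    refine (Finset.abs_sum_le_sum_abs _ _).trans
      ((Finset.sum_le_sum fun i _ => hG.preservesNorm x i).trans ?_)
    rw [← Finset.mul_sum, hbn, mul_one]
  have hτ0 : ∀ x, 0 < τ x := fun x => by
    have h2 := (abs_le.1 (hτd x)).1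
    have h3 : 0 < τ x / d := by linarith
    exact (div_pos_iff_of_pos_right hd').1 h3
  have hεd : 0 < d * (1 + 18 * ε) := by positivity
  have hstate : ∀ x, IsQuantumState (compressedState G ρ x) := fun x => by
    constructor
    · refine (compress_posSemidef G (hρ x).posSemidef).smul ?_
      rw [htr, Complex.ofReal_re]
      exact_mod_cast (inv_pos.2 (hτ0 x)).le
    · rw [compressedState, Matrix.trace_smul, htr, Complex.ofReal_re, smul_eq_mul,
        ← Complex.ofReal_mul, inv_mul_cancel₀ (hτ0 x).ne', Complex.ofReal_one]
  have heff : ∀ M : Matrix (Fin D) (Fin D) ℂ, M.PosSemidef → (compressedEffect ε G M).PosSemidef :=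
    fun M hM => (compress_posSemidef G hM).smul (by exact_mod_cast (inv_pos.2 hεd).le)
  have hpovm : ∀ y, IsPOVM (compressedPOVM ε G (E y)) := fun y => by
    constructor
    · intro z
      refine Fin.lastCases ?_ (fun k => ?_) z
      · simp only [compressedPOVM, Fin.lastCases_last, sum_compressedEffect]
        have hS : (sumButLast (E y)).PosSemidef :=
          Matrix.posSemidef_sum _ fun k _ => (hE y).posSemidef _
        have hS' := heff _ hS
        -- Positivity of the last effect is the quadratic form bound in `IsGood`, divided by `d (1 +
        -- 18 ε)`.
        refine Matrix.posSemidef_iff_dotProduct_mulVec.2 ⟨Matrix.isHermitian_one.sub hS'.1, ?_⟩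
        intro v
        have h2 := (compress_posSemidef G hS).dotProduct_mulVec_nonneg v
        have h3 := hG.bound y v
        have h4 : star v ⬝ᵥ v = ((‖WithLp.toLp 2 v‖ ^ 2 : ℝ) : ℂ) := by
          have := inner_self_eq_norm_sq_to_K (𝕜 := ℂ) (WithLp.toLp 2 v)
          rw [EuclideanSpace.inner_eq_star_dotProduct, dotProduct_comm] at this
          rw [this]; simp
        rw [Matrix.sub_mulVec, Matrix.one_mulVec, dotProduct_sub, h4, compressedEffect,
          Matrix.smul_mulVec, dotProduct_smul, smul_eq_mul]
        rw [Complex.nonneg_iff] at h2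
        rw [Complex.nonneg_iff]
        simp only [Complex.sub_re, Complex.sub_im, Complex.ofReal_re, Complex.ofReal_im,
          Complex.re_ofReal_mul, Complex.im_ofReal_mul, ← h2.2, mul_zero, sub_zero, and_true]
        rw [sub_nonneg, inv_mul_le_iff₀ hεd]
        linarith
      · simp only [compressedPOVM, Fin.lastCases_castSucc]
        exact heff _ ((hE y).posSemidef _)
    · rw [Fin.sum_univ_castSucc]
      simp [compressedPOVM]
  have herr : ∀ x y (k : Fin K),
      ‖(compressedState G ρ x * compressedEffect ε G (E y k.castSucc)).trace -
        (ρ x * E y k.castSucc).trace‖ ≤ 200 * ε * (E y k.castSucc).trace.re := by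
    intro x y k
    set t : ℝ := ∑ j, ‖c y k j‖ ^ 2 with ht
    have htE : (E y k.castSucc).trace = (t : ℂ) := by
      rw [hc]; simp only [Matrix.trace_sum, trace_outer, ht, Complex.ofReal_sum]
    set a₀ : ℝ := ∑ i, ∑ j, ‖inner ℂ (b x i) (c y k j)‖ ^ 2 with ha₀
    have e₀ : (ρ x * E y k.castSucc).trace = (a₀ : ℂ) := by
      rw [hb, hc, trace_sum_outer_mul_sum_outer]
    set a : ℝ := ∑ i, ∑ j, ‖inner ℂ (realLin G (b x i)) (realLin G (c y k j))‖ ^ 2 with ha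
    have e₁ : (compress G (ρ x) * compress G (E y k.castSucc)).trace = (a : ℂ) := by
      rw [hb, hc, compress_sum, compress_sum]
      simp only [compress_outer]
      rw [trace_sum_outer_mul_sum_outer]
    have hbt : ∑ i, ∑ j, ‖b x i‖ ^ 2 * ‖c y k j‖ ^ 2 = t := by
      rw [← Finset.sum_mul_sum, hbn, one_mul]
    have ha₀0 : 0 ≤ a₀ := Finset.sum_nonneg fun i _ => Finset.sum_nonneg fun j _ => by positivity
    have ha₀t : a₀ ≤ t := by
      rw [← hbt]
      refine Finset.sum_le_sum fun i _ => Finset.sum_le_sum fun j _ => ?_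
      rw [← mul_pow]
      exact pow_le_pow_left₀ (norm_nonneg _) (norm_inner_le_norm _ _) 2
    have haa : |a / d ^ 2 - a₀| ≤ 6 * ε * t := by
      have e : a / d ^ 2 - a₀ = (∑ i, ∑ j, (‖inner ℂ (realLin G (b x i)) (realLin G (c y k j))‖ ^ 2
          - d ^ 2 * ‖inner ℂ (b x i) (c y k j)‖ ^ 2)) / d ^ 2 := by
        simp only [Finset.sum_sub_distrib, ← Finset.mul_sum]; field_simp; rfl
      rw [e, abs_div, abs_of_pos (show (0 : ℝ) < d ^ 2 by positivity),
        div_le_iff₀ (by positivity), ← hbt]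
      refine (Finset.abs_sum_le_sum_abs _ _).trans ?_
      rw [Finset.mul_sum, Finset.sum_mul]
      refine Finset.sum_le_sum fun i _ => (Finset.abs_sum_le_sum_abs _ _).trans ?_
      rw [Finset.mul_sum, Finset.sum_mul]
      refine Finset.sum_le_sum fun j _ =>
        (abs_norm_inner_sq_sub_le h0.le h1 (hG.preservesInner x i y k j)).trans (le_of_eq (by ring))
    have ht0 : 0 ≤ t := ha₀0.trans ha₀t
    have hfin := abs_quotient_sub_le h0 h1 ht0 ha₀0 ha₀t haa (hτd x)
    have e₂ : (compressedState G ρ x * compressedEffect ε G (E y k.castSucc)).trace =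
        ((a / d ^ 2 / (τ x / d * (1 + 18 * ε)) : ℝ) : ℂ) := by
      rw [compressedState, compressedEffect, Matrix.smul_mul, Matrix.mul_smul, Matrix.trace_smul,
        Matrix.trace_smul, e₁, htr, Complex.ofReal_re, smul_eq_mul, smul_eq_mul,
        ← Complex.ofReal_mul, ← Complex.ofReal_mul]
      congr 1
      have := (hτ0 x).ne'
      field_simp
    rw [e₂, e₀, htE, Complex.ofReal_re, ← Complex.ofReal_sub, Complex.norm_real, Real.norm_eq_abs]
    exact hfin
  refine ⟨hstate, hpovm, fun x y k => ?_, fun x y => ?_⟩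
  · simp only [compressedPOVM, Fin.lastCases_castSucc]
    exact herr x y k
  · simp only [compressedPOVM, Fin.lastCases_last]
    have hlast : E y (Fin.last K) = 1 - ∑ k : Fin K, E y k.castSucc := by
      rw [← (hE y).sum_eq_one, Fin.sum_univ_castSucc]; abel
    -- Both states have trace one, so the identity contributes nothing and the error is minus the
    -- sum of the other errors.
    have e : (compressedState G ρ x * (1 - ∑ k : Fin K,
        compressedEffect ε G (E y k.castSucc))).trace - (ρ x * E y (Fin.last K)).trace =
        -∑ k : Fin K, ((compressedState G ρ x * compressedEffect ε G (E y k.castSucc)).trace -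
        (ρ x * E y k.castSucc).trace) := by
      rw [hlast]
      simp only [Matrix.mul_sub, Matrix.mul_one, Matrix.mul_sum, Matrix.trace_sub,
        Matrix.trace_sum, (hρ x).trace_eq_one, (hstate x).trace_eq_one, Finset.sum_sub_distrib]
      ring
    rw [e, norm_neg]
    refine (norm_sum_le _ _).trans ((Finset.sum_le_sum fun k _ => herr x y k).trans (le_of_eq ?_))
    rw [← Finset.mul_sum, hlast]
    simp [Matrix.trace_sum]

/-! ### Exponentially decaying eigenvalues -/

/-- Position, counted from `0`, in the list of eigenvalues in descending order. -/
def eigRank {D : ℕ} (i : Fin D) : ℕ :=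
  ((Fintype.equivOfCardEq (Fintype.card_fin (Fintype.card (Fin D)))).symm i :
    Fin (Fintype.card (Fin D)))

lemma eigRank_injective {D : ℕ} : Function.Injective (eigRank : Fin D → ℕ) :=
  Fin.val_injective.comp (Equiv.injective _)

lemma eigRank_lt {D : ℕ} (i : Fin D) : eigRank i < D :=
  lt_of_lt_of_eq (Fin.is_lt _) (Fintype.card_fin D)

/-- The eigenvalues are grouped in blocks of `l`, the first one with `j` additional elements. -/
def eigBlock {D : ℕ} (j l : ℕ) (i : Fin D) : ℕ := (eigRank i + 1 - j) / l

lemma eigBlock_mem_range {D : ℕ} (j l : ℕ) (i : Fin D) : eigBlock j l i ∈ Finset.range (D + 1) := by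
  have h1 := Nat.div_le_self (eigRank i + 1 - j) l
  have h2 := eigRank_lt i
  rw [Finset.mem_range, eigBlock]
  omega

/-- Block `0` consists of the positions below `j + l - 1`, because the subtraction in `eigBlock` is
truncated. Every later block has at most `l` elements, which fits since `j ≥ 1`. -/
lemma card_eigBlock_le {D : ℕ} {j l : ℕ} (hj : 0 < j) (hl : 0 < l) (m : ℕ) :
    (Finset.univ.filter fun i : Fin D => eigBlock j l i = m).card ≤ j + (l - 1) := by
  rw [← Finset.card_image_of_injective _ eigRank_injective]
  rcases Nat.eq_zero_or_pos m with rfl | hm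
  · refine (Finset.card_le_card (t := Finset.range (j + (l - 1))) ?_).trans (by simp)
    intro r hr
    obtain ⟨i, hi, rfl⟩ := Finset.mem_image.1 hr
    have h := (Finset.mem_filter.1 hi).2
    rw [eigBlock, Nat.div_eq_zero_iff] at h
    rw [Finset.mem_range]
    omega
  · refine (Finset.card_le_card (t := Finset.Ico (m * l + j - 1) (m * l + j - 1 + l)) ?_).trans
      (by simp; omega)
    intro r hr
    obtain ⟨i, hi, rfl⟩ := Finset.mem_image.1 hr
    have h := (Finset.mem_filter.1 hi).2
    rw [eigBlock, Nat.div_eq_iff hl] at h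
    have : 0 < m * l := Nat.mul_pos hm hl
    rw [Finset.mem_Ico]
    omega

/-- Rayleigh quotient of `1 - M` at an eigenvector. This covers block `0`, where the tail assumption
need not apply. -/
lemma eigenvalues_le_one {D : ℕ} {M : Matrix (Fin D) (Fin D) ℂ} (hM : M.IsHermitian)
    (h1 : (1 - M).PosSemidef) (i : Fin D) : hM.eigenvalues i ≤ 1 := by
  have h := h1.dotProduct_mulVec_nonneg (hM.eigenvectorBasis i : Fin D → ℂ)
  rw [Matrix.sub_mulVec, Matrix.one_mulVec, dotProduct_sub, Complex.nonneg_iff] at h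
  have h2 := hM.eigenvalues_eq i
  have h3 := inner_self_eq_norm_sq_to_K (𝕜 := ℂ) (hM.eigenvectorBasis i)
  rw [EuclideanSpace.inner_eq_star_dotProduct, dotProduct_comm,
    (hM.eigenvectorBasis).orthonormal.1 i] at h3
  rw [h3] at h
  have h4 := h.1
  rw [h2]
  simpa using h4

/-- The dimension, up to the additive constant `jstar`, of the blocks. -/
def tailLength (b ε : ℝ) : ℕ := ⌊1 / b * Real.log (8 / ε)⌋₊

/-- With `L = (1/b) ln (8/ε)` one has `exp (-b L) = ε / 8`, and the block length `⌊L⌋ + 1` exceeds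
`L`; each further block therefore gains a factor `ε / 8`. -/
lemma eigenvalues_le_pow {D : ℕ} {M : Matrix (Fin D) (Fin D) ℂ} {jstar : ℕ} {b ε : ℝ}
    (hb : 0 < b) (h0 : 0 < ε) (hε : ε ≤ 1 / 2) (hM : M.IsHermitian)
    (hT : ∀ (i : Fin (Fintype.card (Fin D))) (j : ℕ), 0 < j →
      (i : ℕ) + 1 = jstar + j → hM.eigenvalues₀ i ≤ Real.exp (-(b * j)))
    (h1 : (1 - M).PosSemidef) (i : Fin D) :
    hM.eigenvalues i ≤ (ε / 8) ^ eigBlock jstar (tailLength b ε + 1) i := by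
  set L := 1 / b * Real.log (8 / ε) with hL
  have hL0 : 0 < Real.log (8 / ε) := Real.log_pos (by rw [lt_div_iff₀ h0]; linarith)
  have hbL : b * L = Real.log (8 / ε) := by rw [hL]; field_simp
  set l := tailLength b ε + 1 with hl
  have hlL : L ≤ l := by
    rw [hl]; push_cast; exact (Nat.lt_floor_add_one L).le
  rcases Nat.eq_zero_or_pos (eigRank i + 1 - jstar) with hz | hp
  · rw [eigBlock, hz, Nat.zero_div, pow_zero]
    exact eigenvalues_le_one hM h1 i
  -- `eigenvalues i` is by definition the entry of `eigenvalues₀` at the position `eigRank i`; the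
  -- `+ 1` passes to counting from one.
  · refine (hT _ (eigRank i + 1 - jstar) hp (by unfold eigRank at hp ⊢; omega)).trans ?_
    have hq : ε / 8 = Real.exp (-(b * L)) := by
      rw [hbL, Real.exp_neg, Real.exp_log (by positivity), inv_div]
    rw [hq, ← Real.exp_nat_mul, Real.exp_le_exp]
    have h2 : eigBlock jstar l i * l ≤ eigRank i + 1 - jstar := Nat.div_mul_le_self _ _
    have h3 : (eigBlock jstar l i : ℝ) * l ≤ ((eigRank i + 1 - jstar : ℕ) : ℝ) := by exact_mod_cast h2
    have h4 : (eigBlock jstar l i : ℝ) * L ≤ eigBlock jstar l i * l :=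
      mul_le_mul_of_nonneg_left hlL (Nat.cast_nonneg _)
    have := mul_le_mul_of_nonneg_left (h4.trans h3) hb.le
    linarith

/-- The span of the eigenvectors in a block. -/
def blockSpan {D : ℕ} {M : Matrix (Fin D) (Fin D) ℂ} (hM : M.IsHermitian) (j l m : ℕ) :
    Submodule ℂ (EuclideanSpace ℂ (Fin D)) :=
  Submodule.span ℂ 
    (hM.eigenvectorBasis '' (Finset.univ.filter fun i => eigBlock j l i = m : Finset (Fin D)))

lemma finrank_blockSpan_le {D : ℕ} {M : Matrix (Fin D) (Fin D) ℂ} (hM : M.IsHermitian) {j l : ℕ}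
    (hj : 0 < j) (hl : 0 < l) (m : ℕ) :
    Module.finrank ℂ (blockSpan hM j l m) ≤ j + (l - 1) := by
  classical
  rw [blockSpan, ← Finset.coe_image]
  exact (finrank_span_finset_le_card _).trans
    (Finset.card_image_le.trans (card_eigBlock_le hj hl m))

/-- In the eigenbasis the form is `∑ λ_i |⟨G v_i, v⟩|²`. Within a block the weights are at most
`(ε/8)^m` and the squares add up to at most `(1 + 16 ε) d ‖v‖²`; the weights sum to a geometric
series. -/
lemma compress_quadratic_form_le {d D : ℕ} {G : Matrix (Fin d) (Fin D) ℝ}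
    {M : Matrix (Fin D) (Fin D) ℂ} (hM : M.IsHermitian) {ε : ℝ} (h0 : 0 < ε) (hε : ε ≤ 1 / 2)
    {j l : ℕ} (hev : ∀ i, hM.eigenvalues i ≤ (ε / 8) ^ eigBlock j l i)
    (hG : ∀ m ∈ Finset.range (D + 1), ∀ a ∈ blockSpan hM j l m,
      ‖realLin G a‖ ^ 2 ≤ (1 + 8 * (2 * ε)) * d * ‖a‖ ^ 2) (v : Fin d → ℂ) :
    (star v ⬝ᵥ (compress G M).mulVec v).re ≤ (1 + 18 * ε) * d * ‖WithLp.toLp 2 v‖ ^ 2 := by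
  set f : Fin D → ℝ := fun i =>
    ‖inner ℂ (realLin G (hM.eigenvectorBasis i)) (WithLp.toLp 2 v)‖ ^ 2 with hf
  have e : star v ⬝ᵥ (compress G M).mulVec v = ((∑ i, hM.eigenvalues i * f i : ℝ) : ℂ) := by
    conv_lhs => rw [eq_sum_outer hM]
    simp only [compress_sum, compress_smul, compress_outer, Matrix.sum_mulVec, dotProduct_sum,
      Matrix.smul_mulVec, dotProduct_smul, dotProduct_outer_mulVec, smul_eq_mul,
      Complex.ofReal_sum, Complex.ofReal_mul, hf]
  rw [e, Complex.ofReal_re]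
  set W := d * ‖WithLp.toLp 2 v‖ ^ 2 with hW
  have hW0 : 0 ≤ W := by positivity
  have hq0 : 0 ≤ ε / 8 := by positivity
  calc ∑ i, hM.eigenvalues i * f i ≤ ∑ i, (ε / 8) ^ eigBlock j l i * f i :=
        Finset.sum_le_sum fun i _ => mul_le_mul_of_nonneg_right (hev i) (by positivity)
    _ = ∑ m ∈ Finset.range (D + 1), ∑ i with eigBlock j l i = m,
          (ε / 8) ^ eigBlock j l i * f i :=
        (Finset.sum_fiberwise_of_maps_to (fun i _ => eigBlock_mem_range j l i) _).symm
    _ ≤ ∑ m ∈ Finset.range (D + 1), (ε / 8) ^ m * ((1 + 16 * ε) * W) := by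
        refine Finset.sum_le_sum fun m hm => ?_
        have e1 : ∑ i with eigBlock j l i = m, (ε / 8) ^ eigBlock j l i * f i =
            (ε / 8) ^ m * ∑ i with eigBlock j l i = m, f i := by
          rw [Finset.mul_sum]
          refine Finset.sum_congr rfl fun i hi => ?_
          rw [(Finset.mem_filter.1 hi).2]
        rw [e1]
        refine mul_le_mul_of_nonneg_left ?_ (by positivity)
        have := sum_norm_inner_sq_le hM.eigenvectorBasis.orthonormal
          (Finset.univ.filter fun i => eigBlock j l i = m)
          (N := (1 + 8 * (2 * ε)) * d) (by positivity) (hG m hm)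
          (WithLp.toLp 2 v)
        refine this.trans (le_of_eq (by rw [hW]; ring))
    _ = (∑ m ∈ Finset.range (D + 1), (ε / 8) ^ m) * ((1 + 16 * ε) * W) := by rw [Finset.sum_mul]
    _ ≤ (1 - ε / 8)⁻¹ * ((1 + 16 * ε) * W) := by
        refine mul_le_mul_of_nonneg_right ?_ (by positivity)
        rw [← tsum_geometric_of_lt_one hq0 (by linarith)]
        exact (summable_geometric_of_lt_one hq0 (by linarith)).sum_le_tsum _
          fun i _ => by positivity
    _ ≤ (1 + 18 * ε) * W := by
        rw [← mul_assoc]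
        refine mul_le_mul_of_nonneg_right ?_ hW0
        -- What remains is `1 + 16 ε ≤ (1 - ε/8) (1 + 18 ε)`, with slack `(15/8) ε - (9/4) ε²`.
        rw [inv_mul_le_iff₀ (by linarith)]
        nlinarith
    _ = _ := by rw [hW]; ring

/-! ### The success probability -/

lemma measureReal_not_forall_le {Ω ι : Type*} [MeasurableSpace Ω] (μ : Measure Ω)
    [IsProbabilityMeasure μ] [Fintype ι] (P : ι → Ω → Prop) {c : ℝ}
    (h : ∀ i, μ.real {ω | ¬ P i ω} ≤ c) :
    μ.real {ω | ¬ ∀ i, P i ω} ≤ Fintype.card ι * c := by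
  have e : {ω | ¬ ∀ i, P i ω} = ⋃ i ∈ Finset.univ, {ω | ¬ P i ω} := by
    ext; simp
  rw [e]
  refine (measureReal_biUnion_finset_le _ _).trans
    ((Finset.sum_le_card_nsmul _ _ _ fun i _ => h i).trans (le_of_eq ?_))
  rw [nsmul_eq_mul, Finset.card_univ]

/-- Everything is measured in `B = 1 / A`. The first condition on `d` makes each norm or inner
product fail with probability of order `B^8`, which beats the at most `A²` pairs; the total is at
most `B^7 + B^6 + 8 B^15` with `B ≤ 1/4`. -/
lemma failure_bound {x y w n d jstar : ℕ} {ε L A : ℝ} (h0 : 0 < ε) (hA : 4 ≤ A)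
    (hx : 4 * (x : ℝ) ≤ A) (hy : 4 * (y : ℝ) ≤ A) (hw : 2 * (w : ℝ) ≤ A) (hn : (n : ℝ) ≤ jstar + L)
    (h1 : 128 / ε ^ 2 * Real.log A ≤ d) (h2 : 128 / ε ^ 2 * (jstar + L) ≤ d) :
    x * (4 * Real.exp (-(d * ε ^ 2 / 16))) +
      (x * y) * (16 * Real.exp (-(d * ε ^ 2 / 16))) +
      w * (625 ^ n * (16 * Real.exp (-(d * (2 * ε) ^ 2 / 16)))) ≤ 1 / 3 := by
  have hA0 : 0 < A := by linarith
  have hε2 : 0 < ε ^ 2 := by positivity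
  have k1 : 128 * Real.log A ≤ d * ε ^ 2 := by
    rw [div_mul_eq_mul_div, div_le_iff₀ hε2] at h1; exact h1
  have k2 : 128 * (jstar + L) ≤ d * ε ^ 2 := by
    rw [div_mul_eq_mul_div, div_le_iff₀ hε2] at h2; exact h2
  set B := A⁻¹ with hB
  have hB0 : 0 < B := inv_pos.2 hA0
  have hB4 : B ≤ 1 / 4 := by rw [hB, one_div]; exact inv_anti₀ (by norm_num) hA
  have hBe : B = Real.exp (-Real.log A) := by rw [Real.exp_neg, Real.exp_log hA0]
  have hAB : A * B = 1 := mul_inv_cancel₀ hA0.ne'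
  have e1 : Real.exp (-(d * ε ^ 2 / 16)) ≤ B ^ 8 := by
    rw [hBe, ← Real.exp_nat_mul, Real.exp_le_exp]
    push_cast; linarith
  -- The exponent is `d ε² / 4`. Half of it pays for the net, since `625 ≤ e^16` and `d ε² / 8 ≥ 16
  -- n`; the other half is at least `16 ln A`.
  have e2 : 625 ^ n * Real.exp (-(d * (2 * ε) ^ 2 / 16)) ≤ B ^ 16 := by
    have h625 : (625 : ℝ) ^ n ≤ Real.exp (n * 16) := by
      rw [Real.exp_nat_mul]
      refine pow_le_pow_left₀ (by norm_num) ?_ n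
      have : (2 : ℝ) ^ 16 ≤ Real.exp 1 ^ 16 :=
        pow_le_pow_left₀ (by norm_num) (by linarith [Real.add_one_le_exp (1 : ℝ)]) 16
      rw [← Real.exp_nat_mul] at this
      norm_num at this ⊢
      linarith
    calc _ ≤ Real.exp (n * 16) * Real.exp (-(d * (2 * ε) ^ 2 / 16)) :=
          mul_le_mul_of_nonneg_right h625 (Real.exp_pos _).le
      _ ≤ B ^ 16 := by
          rw [hBe, ← Real.exp_nat_mul, ← Real.exp_add, Real.exp_le_exp]
          push_cast; nlinarith
  have hx0 : (0 : ℝ) ≤ x := Nat.cast_nonneg _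
  have hy0 : (0 : ℝ) ≤ y := Nat.cast_nonneg _
  have hw0 : (0 : ℝ) ≤ w := Nat.cast_nonneg _
  have t1 : x * (4 * Real.exp (-(d * ε ^ 2 / 16))) ≤ A * B ^ 8 := by
    calc _ ≤ x * (4 * B ^ 8) := by gcongr
      _ = (4 * x) * B ^ 8 := by ring
      _ ≤ _ := by gcongr
  have t2 : (x * y) * (16 * Real.exp (-(d * ε ^ 2 / 16))) ≤ A * A * B ^ 8 := by
    calc _ ≤ (x * y) * (16 * B ^ 8) := by gcongr
      _ = (4 * x) * (4 * y) * B ^ 8 := by ring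
      _ ≤ _ := by gcongr
  have t3 : w * (625 ^ n * (16 * Real.exp (-(d * (2 * ε) ^ 2 / 16)))) ≤ 8 * A * B ^ 16 := by
    calc _ = 8 * (2 * w) * (625 ^ n * Real.exp (-(d * (2 * ε) ^ 2 / 16))) := by ring
      _ ≤ _ := by gcongr
  have s1 : A * B ^ 8 = B ^ 7 := by linear_combination B ^ 7 * hAB
  have s2 : A * A * B ^ 8 = B ^ 6 := by linear_combination (A * B + 1) * B ^ 6 * hAB
  have s3 : 8 * A * B ^ 16 = 8 * B ^ 15 := by linear_combination 8 * B ^ 15 * hAB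
  have u1 : B ^ 7 ≤ (1 / 4) ^ 7 := pow_le_pow_left₀ hB0.le hB4 7
  have u2 : B ^ 6 ≤ (1 / 4) ^ 6 := pow_le_pow_left₀ hB0.le hB4 6
  have u3 : B ^ 15 ≤ (1 / 4) ^ 15 := pow_le_pow_left₀ hB0.le hB4 15
  norm_num at u1 u2 u3
  linarith

/-- Union bound over `X D` norms, `(X D)(Y K D)` inner products and `Y (D + 1)` blocks, with `A = 4
J D`. The assumption `X + Y > 0` ensures `A ≥ 4`. -/
theorem measure_not_isGood_le {X Y K D d jstar : ℕ} {b ε : ℝ}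
    {E : Fin Y → Fin (K + 1) → Matrix (Fin D) (Fin D) ℂ} (hD : 0 < D) (hXY : 0 < X + Y)
    (hE : ∀ y, IsPOVM (E y)) (hj : 0 < jstar) (hb : 0 < b)
    (hT : ∀ y, HasExpTail (sumButLast (E y)) jstar b) (h0 : 0 < ε) (hε : ε ≤ 1 / 2)
    (h1 : 128 / ε ^ 2 * Real.log (4 * ((X : ℝ) + Y * (K + 1)) * D) ≤ d)
    (h2 : 128 / ε ^ 2 * (jstar + 1 / b * Real.log (8 / ε)) ≤ d)
    (v : Fin X → Fin D → EuclideanSpace ℂ (Fin D))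
    (c : Fin Y → Fin K → Fin D → EuclideanSpace ℂ (Fin D)) :
    RealRAM.gaussianSource.real {ω | ¬ IsGood ε (sourceMatrix d D ω) E v c} ≤ 1 / 3 := by
  choose hM hM' using hT
  set l := tailLength b ε + 1 with hl
  have hlog : 0 < Real.log (8 / ε) := Real.log_pos (by rw [lt_div_iff₀ h0]; linarith)
  have hPS : ∀ y, (1 - sumButLast (E y)).PosSemidef := fun y => by
    have : 1 - sumButLast (E y) = E y (Fin.last K) := by
      rw [← (hE y).sum_eq_one, Fin.sum_univ_castSucc, sumButLast]; abel
    rw [this]; exact (hE y).posSemidef _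
  have hev := fun y i => eigenvalues_le_pow hb h0 hε (hM y) (hM' y) (hPS y) i
  have f1 := measureReal_not_forall_le RealRAM.gaussianSource
    (fun (p : Fin X × Fin D) ω => PreservesNorm ε (sourceMatrix d D ω) (v p.1 p.2))
    (fun p => measure_not_preservesNorm d (v p.1 p.2) h0.le (by linarith))
  have f2 := measureReal_not_forall_le RealRAM.gaussianSource
    (fun (p : (Fin X × Fin D) × (Fin Y × Fin K × Fin D)) ω =>
      PreservesInner ε (sourceMatrix d D ω) (v p.1.1 p.1.2) (c p.2.1 p.2.2.1 p.2.2.2))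
    (fun p => measure_not_preservesInner d _ _ h0.le (by linarith))
  have f3 := measureReal_not_forall_le RealRAM.gaussianSource
    (fun (p : Fin Y × Fin (D + 1)) ω => ∀ a ∈ blockSpan (hM p.1) jstar l p.2,
      ‖realLin (sourceMatrix d D ω) a‖ ^ 2 ≤ (1 + 8 * (2 * ε)) * d * ‖a‖ ^ 2)
    -- The blocks tolerate the accuracy `2 ε`, admissible because `ε ≤ 1/2`; it quadruples the
    -- exponent.
    (fun p => measure_norm_sq_realLin_le d (η := 2 * ε) (by linarith) (by linarith) _
      (finrank_blockSpan_le (hM p.1) hj (Nat.succ_pos _) p.2))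
  refine (measureReal_mono (?_ : _ ⊆ ({ω | _} ∪ {ω | _}) ∪ {ω | _}) (measure_ne_top _ _)).trans
    ((measureReal_union_le _ _).trans
    ((add_le_add ((measureReal_union_le _ _).trans (add_le_add f1 f2)) f3).trans ?_))
  · intro ω hω
    by_contra hcon
    simp only [Set.mem_union, Set.mem_ofPred_eq, not_or, not_not] at hcon
    exact hω
      { preservesNorm := fun x i => hcon.1.1 (x, i)
        preservesInner := fun x i y k j => hcon.1.2 ((x, i), (y, k, j))
        bound := fun y => compress_quadratic_form_le (hM y) h0 hε (hev y)
          fun m hm => hcon.2 (y, ⟨m, Finset.mem_range.1 hm⟩) }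
  · simp only [Fintype.card_prod, Fintype.card_fin]
    rw [Nat.cast_mul (X * D)]
    have hD1 : (1 : ℝ) ≤ D := by exact_mod_cast hD
    have hJ : (1 : ℝ) ≤ (X : ℝ) + Y := by exact_mod_cast hXY
    have hX0 : (0 : ℝ) ≤ X := Nat.cast_nonneg _
    have hY0 : (0 : ℝ) ≤ Y := Nat.cast_nonneg _
    have hK0 : (0 : ℝ) ≤ K := Nat.cast_nonneg _
    have hYK : (0 : ℝ) ≤ Y * K := by positivity
    have hJ1 : (X : ℝ) + Y ≤ X + Y * (K + 1) := by linarith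
    refine failure_bound (jstar := jstar) (A := 4 * ((X : ℝ) + Y * (K + 1)) * D)
      (L := 1 / b * Real.log (8 / ε)) h0 ?_ ?_ ?_ ?_ ?_ h1 h2
    · nlinarith
    · push_cast
      nlinarith
    · push_cast
      have : (Y : ℝ) * K * D ≤ (X + Y * (K + 1)) * D :=
        mul_le_mul_of_nonneg_right (by linarith) (by linarith)
      linarith
    · push_cast
      have h3 : (Y : ℝ) * (D + 1) ≤ Y * (2 * D) := mul_le_mul_of_nonneg_left (by linarith) hY0
      have h4 : (Y : ℝ) * D ≤ (X + Y * (K + 1)) * D :=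
        mul_le_mul_of_nonneg_right (by linarith) (by linarith)
      linarith
    · rw [Nat.succ_sub_one]
      push_cast
      have := Nat.floor_le (a := 1 / b * Real.log (8 / ε)) (by positivity)
      rw [tailLength]
      linarith

end GaussianCompression

namespace RealRAM

/-! ### Running times -/

/-- The value of `e` is at most one of the input sizes. -/
def IdxExp.IsSize (e : IdxExp) : Prop := ∃ w < 5, ∀ σ : ℕ → ℕ, e.eval σ ≤ σ w

/-- All loop counters are bounded by input sizes, and the input sizes are never overwritten. -/
def Prog.IsSized : Prog → Prop
  | .skip => True
  | .seq p q => p.IsSized ∧ q.IsSized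
  | .setIdx v _ => 5 ≤ v
  | .setCell _ _ _ => True
  | .sample _ _ => True
  | .ite _ p q => p.IsSized ∧ q.IsSized
  | .loop v e p => 5 ≤ v ∧ e.IsSize ∧ p.IsSized

/-- A bound for the number of steps as a polynomial in a bound for the input sizes. -/
def Prog.stepBound : Prog → Polynomial ℕ
  | .skip => 0
  | .seq p q => p.stepBound + q.stepBound
  | .setIdx _ e => Polynomial.C (e.cost + 1)
  | .setCell _ is e => Polynomial.C (addrCost is + e.cost + 1)
  | .sample _ is => Polynomial.C (addrCost is + 1)
  | .ite t p q => Polynomial.C (t.cost + 1) + p.stepBound + q.stepBound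
  | .loop _ e p => Polynomial.C (e.cost + 1) + Polynomial.X * (1 + p.stepBound)

/-- Invariant rule: `I i` holds before pass `i`. The number of passes is fixed on entry, so changes
of the variables in `e` do not matter. -/
lemma Prog.loop_induction {ω : ℕ → ℝ} {v : ℕ} {e : IdxExp} {p : Prog} {s : State}
    (I : ℕ → State → Prop) (h0 : I 0 (s.tick (e.cost + 1)))
    (hs : ∀ i < e.eval s.idx, ∀ s', I i s' → I (i + 1) (p.run ω ((s'.putIdx v i).tick 1))) :
    I (e.eval s.idx) ((Prog.loop v e p).run ω s) := by
  have : ∀ n ≤ e.eval s.idx, I n ((List.range n).foldl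
      (fun s' i => p.run ω ((s'.putIdx v i).tick 1)) (s.tick (e.cost + 1))) := by
    intro n
    induction n with
    | zero => intro _; simpa using h0
    | succ n ih =>
      intro hn
      rw [List.range_succ, List.foldl_append]
      exact hs n (by omega) _ (ih (by omega))
  exact this _ le_rfl

@[simp] lemma State.tick_idx (s : State) (n : ℕ) : (s.tick n).idx = s.idx := rfl
@[simp] lemma State.tick_mem (s : State) (n : ℕ) : (s.tick n).mem = s.mem := rfl
@[simp] lemma State.tick_drawn (s : State) (n : ℕ) : (s.tick n).drawn = s.drawn := rfl
@[simp] lemma State.tick_steps (s : State) (n : ℕ) : (s.tick n).steps = s.steps + n := rfl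
@[simp] lemma State.putIdx_idx (s : State) (v n : ℕ) :
    (s.putIdx v n).idx = Function.update s.idx v n := rfl
@[simp] lemma State.putIdx_mem (s : State) (v n : ℕ) : (s.putIdx v n).mem = s.mem := rfl
@[simp] lemma State.putIdx_drawn (s : State) (v n : ℕ) : (s.putIdx v n).drawn = s.drawn := rfl
@[simp] lemma State.putIdx_steps (s : State) (v n : ℕ) : (s.putIdx v n).steps = s.steps := rfl
@[simp] lemma State.putCell_idx (s : State) (a : ℕ) (is : List ℕ) (r : ℝ) :
    (s.putCell a is r).idx = s.idx := rfl
@[simp] lemma State.putCell_drawn (s : State) (a : ℕ) (is : List ℕ) (r : ℝ) :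
    (s.putCell a is r).drawn = s.drawn := rfl
@[simp] lemma State.putCell_steps (s : State) (a : ℕ) (is : List ℕ) (r : ℝ) :
    (s.putCell a is r).steps = s.steps := rfl

lemma State.putCell_mem (s : State) (a : ℕ) (is : List ℕ) (r : ℝ) :
    (s.putCell a is r).mem = fun a' is' => if a' = a ∧ is' = is then r else s.mem a' is' := by
  ext a' is'
  by_cases h : a' = a
  · subst h
    by_cases h' : is' = is
    · subst h'; simp [State.putCell]
    · simp [State.putCell, h']
  · simp [State.putCell, h]

/-- That the input sizes stay intact is proved along with the time bound, because inner and later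
loops need `N` to bound their counters. -/
theorem Prog.steps_run_le {N : ℕ} (ω : ℕ → ℝ) (p : Prog) (hp : p.IsSized) (s : State)
    (hs : ∀ w < 5, s.idx w ≤ N) :
    (p.run ω s).steps ≤ s.steps + p.stepBound.eval N ∧
      ∀ w < 5, (p.run ω s).idx w = s.idx w := by
  induction p generalizing s with
  | skip => simp [Prog.run]
  | seq p q ihp ihq =>
    obtain ⟨h1, h2⟩ := ihp hp.1 s hs
    obtain ⟨h3, h4⟩ := ihq hp.2 (p.run ω s) (fun w hw => by rw [h2 w hw]; exact hs w hw)
    refine ⟨?_, fun w hw => by rw [Prog.run, h4 w hw, h2 w hw]⟩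
    rw [Prog.run, Prog.stepBound, Polynomial.eval_add]
    omega
  | setIdx v e =>
    refine ⟨by simp [Prog.run, Prog.stepBound], fun w hw => ?_⟩
    have : 5 ≤ v := hp
    rw [Prog.run, State.tick_idx, State.putIdx_idx, Function.update_of_ne (by omega)]
  | setCell a is e => simp [Prog.run, Prog.stepBound]
  | sample a is => simp [Prog.run, Prog.stepBound]
  | ite t p q ihp ihq =>
    obtain ⟨h1, h2⟩ := ihp hp.1 (s.tick (t.cost + 1)) hs
    obtain ⟨h3, h4⟩ := ihq hp.2 (s.tick (t.cost + 1)) hs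
    simp only [Prog.run, Prog.stepBound, Polynomial.eval_add, Polynomial.eval_C]
    simp only [State.tick_steps, State.tick_idx] at h1 h2 h3 h4
    split_ifs
    · exact ⟨by omega, h2⟩
    · exact ⟨by omega, h4⟩
  | loop v e p ih =>
    obtain ⟨hv, ⟨w₀, hw₀, he⟩, hp⟩ := hp
    have key := Prog.loop_induction (ω := ω) (v := v) (e := e) (p := p) (s := s)
      (fun i s' => s'.steps ≤ s.steps + (e.cost + 1) + i * (1 + p.stepBound.eval N) ∧
        ∀ w < 5, s'.idx w = s.idx w) (by simp) (by
        rintro i - s' ⟨h1, h2⟩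
        have h3 : ∀ w < 5, ((s'.putIdx v i).tick 1).idx w = s.idx w := fun w hw => by
          rw [State.tick_idx, State.putIdx_idx, Function.update_of_ne (by omega), h2 w hw]
        obtain ⟨h4, h5⟩ := ih hp ((s'.putIdx v i).tick 1)
          (fun w hw => by rw [h3 w hw]; exact hs w hw)
        refine ⟨h4.trans ?_, fun w hw => (h5 w hw).trans (h3 w hw)⟩
        rw [State.tick_steps, State.putIdx_steps, add_mul, one_mul]
        omega)
    refine ⟨key.1.trans ?_, key.2⟩
    simp only [Prog.stepBound, Polynomial.eval_add, Polynomial.eval_C, Polynomial.eval_mul,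
      Polynomial.eval_X, Polynomial.eval_one, add_assoc]
    gcongr
    exact (he _).trans (hs w₀ hw₀)

/-! ### The effect of nested loops -/

/-- `f` depends only on the variables below `n`. -/
def DependsBelow {α : Sort*} (n : ℕ) (f : (ℕ → ℕ) → α) : Prop :=
  ∀ σ σ' : ℕ → ℕ, (∀ w < n, σ w = σ' w) → f σ = f σ'

/-- `f` depends only on the variables below `n` and on the arrays other than `c`. -/
def DependsBelowOff {α : Sort*} (n c : ℕ) (f : (ℕ → ℕ) → Mem → α) : Prop :=
  ∀ (σ σ' : ℕ → ℕ) (m m' : Mem), (∀ w < n, σ w = σ' w) → (∀ a ≠ c, m a = m' a) → f σ m = f σ' m'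

/-- `p` adds `f` to one entry of the array `c`, and changes only variables `≥ n`. -/
structure Adds (p : Prog) (c n : ℕ) (addr : (ℕ → ℕ) → List ℕ) (f : (ℕ → ℕ) → Mem → ℝ) :
    Prop where
  mem_run : ∀ ω s a is, (p.run ω s).mem a is =
    s.mem a is + if a = c ∧ is = addr s.idx then f s.idx s.mem else 0
  idx_run : ∀ ω s, ∀ w < n, (p.run ω s).idx w = s.idx w
  depends : DependsBelowOff n c f

lemma Adds.setCell (c n : ℕ) (is : List IdxExp) (t : RealExp)
    (ht : DependsBelowOff n c fun σ m => t.eval σ m) :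
    Adds (.setCell c is (.add (.cell c is) t)) c n (fun σ => is.map (IdxExp.eval σ))
      fun σ m => t.eval σ m where
  mem_run ω s a js := by
    rw [Prog.run, State.tick_mem, State.putCell_mem]
    by_cases h : a = c ∧ js = is.map (IdxExp.eval s.idx)
    · simp only [if_pos h]; rw [h.1, h.2]; rfl
    · simp only [if_neg h, add_zero]
  idx_run ω s w _ := rfl
  depends := ht

lemma update_eq_of_agree {v : ℕ} {σ σ' : ℕ → ℕ} (h : ∀ w < v, σ w = σ' w) (i : ℕ) :
    ∀ w < v + 1, Function.update σ v i w = Function.update σ' v i w := by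
  intro w hw
  rcases eq_or_ne w v with rfl | hne
  · simp
  · rw [Function.update_of_ne hne, Function.update_of_ne hne, h w (by omega)]

/-- The summand does not read the array `c`, so partial sums stored there do not disturb later
passes. Loop variables are numbered from outside to inside, so wrapping a loop lowers the threshold
from `v + 1` to `v`. -/
lemma Adds.loop {p : Prog} {c v : ℕ} {addr : (ℕ → ℕ) → List ℕ} {f : (ℕ → ℕ) → Mem → ℝ}
    (h : Adds p c (v + 1) addr f) {e : IdxExp} (he : DependsBelow v fun σ => e.eval σ)
    (haddr : DependsBelow v addr) :
    Adds (.loop v e p) c v addr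
      fun σ m => ∑ i ∈ Finset.range (e.eval σ), f (Function.update σ v i) m where
  mem_run ω s := by
    refine (Prog.loop_induction (ω := ω) (v := v) (e := e) (p := p) (s := s)
      (fun i s' => (∀ a is, s'.mem a is = s.mem a is + if a = c ∧ is = addr s.idx then
        ∑ j ∈ Finset.range i, f (Function.update s.idx v j) s.mem else 0) ∧
        ∀ w < v, s'.idx w = s.idx w) (by simp) ?_).1
    rintro i - s' ⟨h1, h2⟩
    have hidx : ∀ w < v, ((s'.putIdx v i).tick 1).idx w = s.idx w := fun w hw => by
      rw [State.tick_idx, State.putIdx_idx, Function.update_of_ne hw.ne, h2 w hw]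
    refine ⟨fun a is => ?_, fun w hw => by rw [h.idx_run ω _ w (by omega), hidx w hw]⟩
    rw [h.mem_run, haddr _ s.idx hidx, State.tick_mem, State.putIdx_mem, h1, add_assoc]
    congr 1
    split_ifs with hc
    · rw [Finset.sum_range_succ]
      congr 1
      refine h.depends _ _ _ _ (update_eq_of_agree h2 i) fun a ha => ?_
      ext is
      simp [h1, ha]
    · simp
  idx_run ω s := by
    refine Prog.loop_induction (ω := ω) (v := v) (e := e) (p := p) (s := s)
      (fun i s' => ∀ w < v, s'.idx w = s.idx w) (by simp) ?_
    intro i _ s' h2 w hw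
    rw [h.idx_run ω _ w (by omega), State.tick_idx, State.putIdx_idx,
      Function.update_of_ne hw.ne, h2 w hw]
  depends := by
    intro σ σ' m m' hσ hm
    simp only [he σ σ' hσ]
    exact Finset.sum_congr rfl fun i _ => h.depends _ _ _ _ (update_eq_of_agree hσ i) hm

open scoped Classical in
/-- `p` overwrites the entries of the array `c` with the addresses in `W` by the values of `g`, and
changes only variables `≥ n`; the values `g` depend only on the input sizes and on the other
arrays. -/
structure Writes (p : Prog) (c n : ℕ) (W : (ℕ → ℕ) → Set (List ℕ))
    (g : (ℕ → ℕ) → Mem → List ℕ → ℝ) : Prop where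
  mem_run : ∀ ω s a is, (p.run ω s).mem a is =
    if a = c ∧ is ∈ W s.idx then g s.idx s.mem is else s.mem a is
  idx_run : ∀ ω s, ∀ w < n, (p.run ω s).idx w = s.idx w
  depends : DependsBelowOff 5 c g
  depends_addr : DependsBelow n W

/-- Initialization turns an accumulation into an assignment, again because the summand ignores `c`.
-/
lemma Adds.writes {q : Prog} {c n : ℕ} {is : List IdxExp} {init : RealExp}
    {f : (ℕ → ℕ) → Mem → ℝ} {g : (ℕ → ℕ) → Mem → List ℕ → ℝ}
    (h : Adds q c n (fun σ => is.map (IdxExp.eval σ)) f)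
    (haddr : DependsBelow n fun σ => is.map (IdxExp.eval σ)) (hg : DependsBelowOff 5 c g)
    (hfg : ∀ σ m, g σ m (is.map (IdxExp.eval σ)) = init.eval σ m + f σ m) :
    Writes (.seq (.setCell c is init) q) c n (fun σ => {is.map (IdxExp.eval σ)}) g where
  mem_run ω s a js := by
    rw [Prog.run, h.mem_run, Prog.run, State.tick_mem, State.putCell_mem, State.tick_idx,
      State.putCell_idx]
    by_cases hc : a = c ∧ js = is.map (IdxExp.eval s.idx)
    · simp only [Set.mem_singleton_iff, if_pos hc]
      rw [hc.2, hfg]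
      congr 1
      refine h.depends _ _ _ _ (fun _ _ => rfl) fun a' ha' => ?_
      ext; simp [ha']
    · simp only [Set.mem_singleton_iff, if_neg hc, add_zero]
  idx_run ω s w hw := by rw [Prog.run, h.idx_run ω _ w hw]; rfl
  depends := hg
  depends_addr σ σ' hσ := by
    have : is.map (IdxExp.eval σ) = is.map (IdxExp.eval σ') := haddr σ σ' hσ
    simp only [this]

/-- The value at an address depends neither on loop variables nor on `c`, so the order and the
repetition of writes are irrelevant and the written sets simply unite. -/
lemma Writes.loop {p : Prog} {c v : ℕ} {W : (ℕ → ℕ) → Set (List ℕ)}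
    {g : (ℕ → ℕ) → Mem → List ℕ → ℝ} (h : Writes p c (v + 1) W g) (hv : 5 ≤ v) {e : IdxExp}
    (he : DependsBelow v fun σ => e.eval σ) :
    Writes (.loop v e p) c v (fun σ => {is | ∃ i < e.eval σ, is ∈ W (Function.update σ v i)}) g where
  mem_run ω s := by
    classical
    have := (Prog.loop_induction (ω := ω) (v := v) (e := e) (p := p) (s := s)
      (fun i s' => (∀ a is, s'.mem a is =
        if a = c ∧ ∃ j < i, is ∈ W (Function.update s.idx v j) then g s.idx s.mem is
          else s.mem a is) ∧ ∀ w < v, s'.idx w = s.idx w) (by simp) ?_).1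
    · intro a is
      convert this a is
      exact Iff.rfl
    rintro i - s' ⟨h1, h2⟩
    refine ⟨fun a is => ?_, fun w hw => by
      rw [h.idx_run ω _ w (by omega), State.tick_idx, State.putIdx_idx,
        Function.update_of_ne hw.ne, h2 w hw]⟩
    have hW := h.depends_addr _ _ (update_eq_of_agree h2 i)
    have hgs : g (Function.update s'.idx v i) s'.mem = g s.idx s.mem := by
      refine h.depends _ _ _ _ (fun w hw => ?_) fun a ha => ?_
      · rw [Function.update_of_ne (by omega), h2 w (by omega)]
      · ext; simp [h1, ha]
    rw [h.mem_run, State.tick_idx, State.putIdx_idx, State.tick_mem, State.putIdx_mem, hW, hgs, h1]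
    by_cases hc : a = c
    · by_cases hi : is ∈ W (Function.update s.idx v i)
      · rw [if_pos ⟨hc, hi⟩, if_pos ⟨hc, i, by omega, hi⟩]
      · rw [if_neg (fun h => hi h.2)]
        refine if_congr (and_congr_right fun _ => ⟨fun ⟨j, hj, hj'⟩ => ⟨j, by omega, hj'⟩,
          fun ⟨j, hj, hj'⟩ => ⟨j, ?_, hj'⟩⟩) rfl rfl
        rcases Nat.lt_succ_iff_lt_or_eq.1 hj with hj | rfl
        · exact hj
        · exact absurd hj' hi
    · simp [hc]
  idx_run ω s := by
    refine Prog.loop_induction (ω := ω) (v := v) (e := e) (p := p) (s := s)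
      (fun i s' => ∀ w < v, s'.idx w = s.idx w) (by simp) ?_
    intro i _ s' h2 w hw
    rw [h.idx_run ω _ w (by omega), State.tick_idx, State.putIdx_idx,
      Function.update_of_ne hw.ne, h2 w hw]
  depends := h.depends
  depends_addr σ σ' hσ := by
    ext is
    have hn : e.eval σ = e.eval σ' := he σ σ' hσ
    simp only [Set.mem_ofPred_eq, hn]
    exact exists_congr fun i => and_congr_right fun _ => by
      rw [h.depends_addr _ _ (update_eq_of_agree hσ i)]

/-! ### The compression program -/

open Prog in
/-- Fill the array `9` with a `d × D` matrix `G` of random numbers. -/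
def sampleProg : Prog :=
  loop 5 (.var 4) (loop 6 (.var 3) (sample 9 [.var 5, .var 6]))

/-- One term of the entry `(i, j)` of `G M Gᵀ`, where the matrix `M` is in the array `a`. -/
def compressTerm (a : ℕ) (pre : List IdxExp) (i j k l : ℕ) : RealExp :=
  .mul (.mul (.cell 9 [.var i, .var k]) (.cell a (pre ++ [.var k, .var l])))
    (.cell 9 [.var j, .var l])

/-- The number of outcomes but the last one. -/
def lastOutcome : IdxExp := .sub (.var 2) (.const 1)

/-- The normalization `d (1 + 18 ε)` of the effects. -/
def effectScale : RealExp :=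
  .mul (.ofIdx (.var 4)) (.add (.ofIdx (.const 1)) (.mul (.ofIdx (.const 18)) (.cell 0 [])))

/-- Set an entry to `init`, and then add up terms by means of a nested loop. -/
def accumulate (c : ℕ) (is : List IdxExp) (init term : RealExp) (loops : List (ℕ × IdxExp)) :
    Prog :=
  .seq (.setCell c is init)
    (loops.foldr (fun l p => .loop l.1 l.2 p) (.setCell c is (.add (.cell c is) term)))

open Prog in
/-- Compute the real parts of the traces of the matrices `G ρ_x Gᵀ` in the array `10`. -/
def traceProg : Prog :=
  loop 5 (.var 0) <| accumulate 10 [.var 5] (.ofIdx (.const 0)) (compressTerm 1 [.var 5] 6 6 7 8)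
    [(6, .var 4), (7, .var 3), (8, .var 3)]

open Prog in
/-- Compute the real or imaginary parts of the states. -/
def stateProg (a c : ℕ) : Prog :=
  loop 5 (.var 0) <| loop 6 (.var 4) <| loop 7 (.var 4) <|
    accumulate c [.var 5, .var 6, .var 7] (.ofIdx (.const 0))
      (.div (compressTerm a [.var 5] 6 7 8 9) (.cell 10 [.var 5])) [(8, .var 3), (9, .var 3)]

open Prog in
/-- Compute the real or imaginary parts of the effects for all outcomes but the last one. -/
def effectProg (a c : ℕ) : Prog :=
  loop 5 (.var 1) <| loop 6 lastOutcome <| loop 7 (.var 4) <| loop 8 (.var 4) <|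
    accumulate c [.var 5, .var 6, .var 7, .var 8] (.ofIdx (.const 0))
      (.div (compressTerm a [.var 5, .var 6] 7 8 9 10) effectScale) [(9, .var 3), (10, .var 3)]

open Prog in
/-- Compute the real or imaginary parts of the effects for the last outcome. -/
def lastEffectProg (a c : ℕ) (init : IdxExp) : Prog :=
  loop 5 (.var 1) <| loop 6 (.var 4) <| loop 7 (.var 4) <|
    -- Outcomes are counted from `0`, so `lastOutcome` is both the number `Z - 1` of other outcomes
    -- and the index of the last one.
    accumulate c [.var 5, lastOutcome, .var 6, .var 7] (.ofIdx init)
      (.sub (.ofIdx (.const 0)) (.div (compressTerm a [.var 5, .var 8] 6 7 9 10) effectScale))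
      [(8, lastOutcome), (9, .var 3), (10, .var 3)]

/-- The Kronecker delta of the variables `6` and `7`. -/
def deltaExp : IdxExp :=
  -- The truncated differences add up to the distance of the indices, and truncation from `1` leaves
  -- `1` exactly when it is zero.
  .sub (.const 1) (.add (.sub (.var 6) (.var 7)) (.sub (.var 7) (.var 6)))

open Prog in
/-- The program that computes the compressed model. -/
def compressProg : Prog :=
  seq sampleProg <| seq traceProg <| seq (stateProg 1 5) <| seq (stateProg 2 6) <|
    seq (effectProg 3 7) <| seq (effectProg 4 8) <| seq (lastEffectProg 3 7 deltaExp)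
      (lastEffectProg 4 8 (.const 0))

lemma isSize_var {w : ℕ} (hw : w < 5) : (IdxExp.var w).IsSize := ⟨w, hw, fun _ => le_rfl⟩

lemma isSize_lastOutcome : lastOutcome.IsSize := ⟨2, by norm_num, fun _ => Nat.sub_le _ _⟩

lemma compressProg_isSized : compressProg.IsSized := by
  simp [compressProg, Prog.IsSized, sampleProg, traceProg, stateProg, effectProg, lastEffectProg,
    accumulate, isSize_var, isSize_lastOutcome]

/-! ### Correctness of the parts of the program -/

/-- The invariant `drawn = i * D + k` ties the order of the draws to the row by row layout of
`sourceMatrix`. -/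
lemma sampleProg_run (ω : ℕ → ℝ) (s : State) (hs : s.drawn = 0) :
    (∀ i < s.idx 4, ∀ k < s.idx 3, (sampleProg.run ω s).mem 9 [i, k] = ω (i * s.idx 3 + k)) ∧
      (∀ a ≠ 9, (sampleProg.run ω s).mem a = s.mem a) ∧
      ∀ w < 5, (sampleProg.run ω s).idx w = s.idx w := by
  have key := Prog.loop_induction (ω := ω) (v := 5) (e := .var 4)
    (p := .loop 6 (.var 3) (.sample 9 [.var 5, .var 6])) (s := s)
    (fun i s' => (∀ j < i, ∀ k < s.idx 3, s'.mem 9 [j, k] = ω (j * s.idx 3 + k)) ∧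
      (∀ a ≠ 9, s'.mem a = s.mem a) ∧ s'.drawn = i * s.idx 3 ∧ ∀ w < 5, s'.idx w = s.idx w)
    (by simp [hs]) (by
      rintro i - s' ⟨h1, h2, h3, h4⟩
      have key' := Prog.loop_induction (ω := ω) (v := 6) (e := .var 3)
        (p := .sample 9 [.var 5, .var 6]) (s := (s'.putIdx 5 i).tick 1)
        (fun k t => (∀ j < i, ∀ k < s.idx 3, t.mem 9 [j, k] = ω (j * s.idx 3 + k)) ∧
          (∀ k' < k, t.mem 9 [i, k'] = ω (i * s.idx 3 + k')) ∧
          (∀ a ≠ 9, t.mem a = s.mem a) ∧ t.drawn = i * s.idx 3 + k ∧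
          (∀ w < 5, t.idx w = s.idx w) ∧ t.idx 5 = i)
        (by
          refine ⟨h1, by simp, h2, h3, fun w hw => ?_, by simp⟩
          simp [Function.update_of_ne hw.ne, h4 w hw]) (by
          rintro k - t ⟨g1, g2, g3, g4, g5, g6⟩
          have e : ((Prog.sample 9 [.var 5, .var 6]).run ω ((t.putIdx 6 k).tick 1)).mem =
              fun a is => if a = 9 ∧ is = [i, k] then ω (i * s.idx 3 + k) else t.mem a is := by
            rw [Prog.run, State.tick_mem]
            simp only [State.putCell_mem]
            simp [IdxExp.eval, g6, g4]
          simp only [e]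
          refine ⟨fun j hj k' hk' => ?_, fun k' hk' => ?_, fun a ha => ?_, ?_, fun w hw => ?_, ?_⟩
          · rw [if_neg (by simp; omega)]; exact g1 j hj k' hk'
          · rcases Nat.lt_succ_iff_lt_or_eq.1 hk' with h | rfl
            · rw [if_neg (by simp; omega)]; exact g2 k' h
            · simp
          · simp [ha, g3 a ha]
          · simp [Prog.run, g4]; ring
          · simp [Prog.run, Function.update_of_ne (show w ≠ 6 by omega), g5 w hw]
          · simp [Prog.run, g6])
      have hn : IdxExp.eval ((s'.putIdx 5 i).tick 1).idx (.var 3) = s.idx 3 := by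
        simp [IdxExp.eval, h4]
      rw [hn] at key'
      obtain ⟨k1, k2, k3, k4, k5, -⟩ := key'
      refine ⟨fun j hj k hk => ?_, k3, by rw [k4]; ring, k5⟩
      rcases Nat.lt_succ_iff_lt_or_eq.1 hj with h | rfl
      · exact k1 j h k hk
      · exact k2 k hk)
  exact ⟨key.1, key.2.1, key.2.2.2⟩

/-- The real or imaginary part of the entry `(i, j)` of `G M Gᵀ`, computed from the memory. -/
def compressSum (D : ℕ) (m : Mem) (a : ℕ) (pre : List ℕ) (i j : ℕ) : ℝ :=
  ∑ k ∈ Finset.range D, ∑ l ∈ Finset.range D, m 9 [i, k] * m a (pre ++ [k, l]) * m 9 [j, l]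

lemma compressSum_congr {D : ℕ} {m m' : Mem} {a c : ℕ} (ha : a ≠ c) (hc : c ≠ 9)
    (h : ∀ a ≠ c, m a = m' a) : compressSum D m a = compressSum D m' a := by
  ext pre i j
  simp only [compressSum, h a ha, h 9 hc.symm]

lemma traceProg_writes : Writes traceProg 10 5 (fun σ => {is | ∃ x < σ 0, is = [x]})
    fun σ m is => match is with
      | [x] => ∑ i ∈ Finset.range (σ 4), compressSum (σ 3) m 1 [x] i i
      | _ => 0 := by
  -- The threshold `9` is one above the innermost loop variable `8`; each loop wrapped around lowers
  -- it by one, down to `5`.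
  have h1 := Adds.setCell 10 9 [.var 5] (compressTerm 1 [.var 5] 6 6 7 8) (by
    intro σ σ' m m' hσ hm
    simp [compressTerm, RealExp.eval, IdxExp.eval, hσ, hm])
  have h2 := ((h1.loop (v := 8) (e := .var 3) (fun σ σ' h => h 3 (by norm_num))
    (fun σ σ' h => by simp [IdxExp.eval, h])).loop (v := 7) (e := .var 3)
    (fun σ σ' h => h 3 (by norm_num)) (fun σ σ' h => by simp [IdxExp.eval, h])).loop (v := 6)
    (e := .var 4) (fun σ σ' h => h 4 (by norm_num)) (fun σ σ' h => by simp [IdxExp.eval, h])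
  have h3 := (h2.writes (init := .ofIdx (.const 0)) (g := fun σ m is => match is with
      | [x] => ∑ i ∈ Finset.range (σ 4), compressSum (σ 3) m 1 [x] i i
      | _ => 0) (fun σ σ' h => by simp [IdxExp.eval, h]) (by
        intro σ σ' m m' hσ hm
        ext is
        simp only [hσ 3 (by norm_num), hσ 4 (by norm_num),
          compressSum_congr (show 1 ≠ 10 by norm_num) (by norm_num) hm]) (by
        intro σ m
        simp [compressTerm, compressSum, RealExp.eval, IdxExp.eval])).loop
    (v := 5) le_rfl (e := .var 0) (fun σ σ' h => h 0 (by norm_num))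
  convert (show Writes traceProg 10 5 _ _ from h3) using 1
  ext σ is
  simp [IdxExp.eval]

lemma stateProg_writes {a c : ℕ} (ha : a ≠ c) (hc : c ≠ 9) (hc' : c ≠ 10) :
    Writes (stateProg a c) c 5
      (fun σ => {is | ∃ x < σ 0, ∃ i < σ 4, ∃ j < σ 4, is = [x, i, j]})
      fun σ m is => match is with
        | [x, i, j] => compressSum (σ 3) m a [x] i j / m 10 [x]
        | _ => 0 := by
  have h1 := Adds.setCell c 10 [.var 5, .var 6, .var 7]
    (.div (compressTerm a [.var 5] 6 7 8 9) (.cell 10 [.var 5])) (by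
    intro σ σ' m m' hσ hm
    simp [compressTerm, RealExp.eval, IdxExp.eval, hσ, hm _ ha, hm 9 hc.symm, hm 10 hc'.symm])
  have h2 := (h1.loop (v := 9) (e := .var 3) (fun σ σ' h => h 3 (by norm_num))
    (fun σ σ' h => by simp [IdxExp.eval, h])).loop (v := 8) (e := .var 3)
    (fun σ σ' h => h 3 (by norm_num)) (fun σ σ' h => by simp [IdxExp.eval, h])
  have h3 := (((h2.writes (init := .ofIdx (.const 0)) (g := fun σ m is => match is with
      | [x, i, j] => compressSum (σ 3) m a [x] i j / m 10 [x]
      | _ => 0) (fun σ σ' h => by simp [IdxExp.eval, h]) (by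
        intro σ σ' m m' hσ hm
        ext is
        simp only [hσ 3 (by norm_num), compressSum_congr ha hc hm, hm 10 hc'.symm]) (by
        intro σ m
        simp [compressTerm, compressSum, RealExp.eval, IdxExp.eval,
          Finset.sum_div])).loop
    (v := 7) (by norm_num) (e := .var 4) (fun σ σ' h => h 4 (by norm_num))).loop
    (v := 6) (by norm_num) (e := .var 4) (fun σ σ' h => h 4 (by norm_num))).loop
    (v := 5) le_rfl (e := .var 0) (fun σ σ' h => h 0 (by norm_num))
  convert (show Writes (stateProg a c) c 5 _ _ from h3) using 1
  ext σ is
  simp [IdxExp.eval]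

lemma effectProg_writes {a c : ℕ} (ha : a ≠ c) (hc : c ≠ 9) (hc' : c ≠ 0) :
    Writes (effectProg a c) c 5
      (fun σ => {is | ∃ y < σ 1, ∃ z < σ 2 - 1, ∃ i < σ 4, ∃ j < σ 4, is = [y, z, i, j]})
      fun σ m is => match is with
        | [y, z, i, j] => compressSum (σ 3) m a [y, z] i j / (σ 4 * (1 + 18 * m 0 []))
        | _ => 0 := by
  have h1 := Adds.setCell c 11 [.var 5, .var 6, .var 7, .var 8]
    (.div (compressTerm a [.var 5, .var 6] 7 8 9 10) effectScale) (by
    intro σ σ' m m' hσ hm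
    simp [compressTerm, effectScale, RealExp.eval, IdxExp.eval, hσ, hm _ ha, hm 9 hc.symm,
      hm 0 hc'.symm])
  have h2 := (h1.loop (v := 10) (e := .var 3) (fun σ σ' h => h 3 (by norm_num))
    (fun σ σ' h => by simp [IdxExp.eval, h])).loop (v := 9) (e := .var 3)
    (fun σ σ' h => h 3 (by norm_num)) (fun σ σ' h => by simp [IdxExp.eval, h])
  have h3 := ((((h2.writes (init := .ofIdx (.const 0)) (g := fun σ m is => match is with
      | [y, z, i, j] => compressSum (σ 3) m a [y, z] i j / (σ 4 * (1 + 18 * m 0 []))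
      | _ => 0) (fun σ σ' h => by simp [IdxExp.eval, h]) (by
        intro σ σ' m m' hσ hm
        ext is
        simp only [hσ 3 (by norm_num), hσ 4 (by norm_num), compressSum_congr ha hc hm,
          hm 0 hc'.symm]) (by
        intro σ m
        simp [compressTerm, effectScale, compressSum, RealExp.eval, IdxExp.eval,
          Finset.sum_div])).loop
    (v := 8) (by norm_num) (e := .var 4) (fun σ σ' h => h 4 (by norm_num))).loop
    (v := 7) (by norm_num) (e := .var 4) (fun σ σ' h => h 4 (by norm_num))).loop
    (v := 6) (by norm_num) (e := lastOutcome)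
      (fun σ σ' h => by simp [lastOutcome, IdxExp.eval, h])).loop
    (v := 5) le_rfl (e := .var 1) (fun σ σ' h => h 1 (by norm_num))
  convert (show Writes (effectProg a c) c 5 _ _ from h3) using 1
  ext σ is
  simp [IdxExp.eval, lastOutcome]

/-- The initial value reads the loop variables `6` and `7`, whereas the written value may depend
only on the address; `f` expresses it through the entries `i`, `j` of the address. -/
lemma lastEffectProg_writes {a c : ℕ} (ha : a ≠ c) (hc : c ≠ 9) (hc' : c ≠ 0) {init : IdxExp}
    {f : ℕ → ℕ → ℕ} (hf : ∀ σ, init.eval σ = f (σ 6) (σ 7)) :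
    Writes (lastEffectProg a c init) c 5
      (fun σ => {is | ∃ y < σ 1, ∃ i < σ 4, ∃ j < σ 4, is = [y, σ 2 - 1, i, j]})
      fun σ m is => match is with
        | [y, _, i, j] => f i j - ∑ z ∈ Finset.range (σ 2 - 1),
            compressSum (σ 3) m a [y, z] i j / (σ 4 * (1 + 18 * m 0 []))
        | _ => 0 := by
  have h1 := Adds.setCell c 11 [.var 5, lastOutcome, .var 6, .var 7]
    (.sub (.ofIdx (.const 0)) (.div (compressTerm a [.var 5, .var 8] 6 7 9 10) effectScale)) (by
    intro σ σ' m m' hσ hm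
    simp [compressTerm, effectScale, RealExp.eval, IdxExp.eval, hσ, hm _ ha, hm 9 hc.symm,
      hm 0 hc'.symm])
  have h2 := ((h1.loop (v := 10) (e := .var 3) (fun σ σ' h => h 3 (by norm_num))
    (fun σ σ' h => by simp [IdxExp.eval, lastOutcome, h])).loop (v := 9) (e := .var 3)
    (fun σ σ' h => h 3 (by norm_num)) (fun σ σ' h => by simp [IdxExp.eval, lastOutcome, h])).loop
    (v := 8) (e := lastOutcome) (fun σ σ' h => by simp [IdxExp.eval, lastOutcome, h])
    (fun σ σ' h => by simp [IdxExp.eval, lastOutcome, h])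
  have h3 := (((h2.writes (init := .ofIdx init) (g := fun σ m is => match is with
      | [y, _, i, j] => f i j - ∑ z ∈ Finset.range (σ 2 - 1),
            compressSum (σ 3) m a [y, z] i j / (σ 4 * (1 + 18 * m 0 []))
      | _ => 0) (fun σ σ' h => by simp [IdxExp.eval, lastOutcome, h]) (by
        intro σ σ' m m' hσ hm
        ext is
        simp only [hσ 2 (by norm_num), hσ 3 (by norm_num), hσ 4 (by norm_num),
          compressSum_congr ha hc hm, hm 0 hc'.symm]) (by
        intro σ m
        simp [compressTerm, effectScale, compressSum, RealExp.eval, IdxExp.eval, lastOutcome,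
          Finset.sum_div, hf, sub_eq_add_neg])).loop
    (v := 7) (by norm_num) (e := .var 4) (fun σ σ' h => h 4 (by norm_num))).loop
    (v := 6) (by norm_num) (e := .var 4) (fun σ σ' h => h 4 (by norm_num))).loop
    (v := 5) le_rfl (e := .var 1) (fun σ σ' h => h 1 (by norm_num))
  convert (show Writes (lastEffectProg a c init) c 5 _ _ from h3) using 1
  ext σ is
  simp [IdxExp.eval, lastOutcome]

open GaussianCompression

/-! ### Correctness of the program -/

lemma Writes.mem_of_ne {p : Prog} {c n : ℕ} {W : (ℕ → ℕ) → Set (List ℕ)}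
    {g : (ℕ → ℕ) → Mem → List ℕ → ℝ} (h : Writes p c n W g) (ω : ℕ → ℝ) (s : State) {a : ℕ}
    (ha : a ≠ c) : (p.run ω s).mem a = s.mem a := by
  ext is
  rw [h.mem_run, if_neg (fun h => ha h.1)]

lemma Writes.mem_of_mem {p : Prog} {c n : ℕ} {W : (ℕ → ℕ) → Set (List ℕ)}
    {g : (ℕ → ℕ) → Mem → List ℕ → ℝ} (h : Writes p c n W g) (ω : ℕ → ℝ) (s : State) {is : List ℕ}
    (his : is ∈ W s.idx) : (p.run ω s).mem c is = g s.idx s.mem is := by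
  rw [h.mem_run, if_pos ⟨rfl, his⟩]

lemma Writes.mem_of_notMem {p : Prog} {c n : ℕ} {W : (ℕ → ℕ) → Set (List ℕ)}
    {g : (ℕ → ℕ) → Mem → List ℕ → ℝ} (h : Writes p c n W g) (ω : ℕ → ℝ) (s : State) {is : List ℕ}
    (his : is ∉ W s.idx) : (p.run ω s).mem c is = s.mem c is := by
  rw [h.mem_run, if_neg fun h => his h.2]

lemma compressSum_eq_of_eq {D : ℕ} {m m' : Mem} {a : ℕ} (h9 : m 9 = m' 9) (ha : m a = m' a) :
    compressSum D m a = compressSum D m' a := by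
  ext pre i j
  simp only [compressSum, h9, ha]

lemma compress_apply {d D : ℕ} (G : Matrix (Fin d) (Fin D) ℝ) (M : Matrix (Fin D) (Fin D) ℂ)
    (i j : Fin d) : compress G M i j = ∑ k, ∑ l, (G i k : ℂ) * M k l * (G j l : ℂ) := by
  simp only [compress, Matrix.mul_apply, Finset.sum_mul, Matrix.map_apply,
    Matrix.conjTranspose_apply, RCLike.star_def, Complex.conj_ofReal]
  exact Finset.sum_comm

/-- Since `G` is real, the real part of `G M Gᵀ` involves only the real part of `M`, so the same
code serves real and imaginary parts. -/
lemma compressSum_eq_re {d D : ℕ} {ω : ℕ → ℝ} {m : Mem} {a : ℕ} {pre : List ℕ}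
    {M : Matrix (Fin D) (Fin D) ℂ} (h9 : ∀ i < d, ∀ k < D, m 9 [i, k] = ω (i * D + k))
    (ha : ∀ k l : Fin D, m a (pre ++ [(k : ℕ), (l : ℕ)]) = (M k l).re) (i j : Fin d) :
    compressSum D m a pre i j = (compress (sourceMatrix d D ω) M i j).re := by
  simp only [compressSum, compress_apply, Finset.sum_range, ha, h9 i i.2 _ (Fin.is_lt _),
    h9 j j.2 _ (Fin.is_lt _), Complex.re_sum, sourceMatrix, Matrix.of_apply]
  simp [Complex.mul_re]

lemma compressSum_eq_im {d D : ℕ} {ω : ℕ → ℝ} {m : Mem} {a : ℕ} {pre : List ℕ}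
    {M : Matrix (Fin D) (Fin D) ℂ} (h9 : ∀ i < d, ∀ k < D, m 9 [i, k] = ω (i * D + k))
    (ha : ∀ k l : Fin D, m a (pre ++ [(k : ℕ), (l : ℕ)]) = (M k l).im) (i j : Fin d) :
    compressSum D m a pre i j = (compress (sourceMatrix d D ω) M i j).im := by
  simp only [compressSum, compress_apply, Finset.sum_range, ha, h9 i i.2 _ (Fin.is_lt _),
    h9 j j.2 _ (Fin.is_lt _), Complex.im_sum, sourceMatrix, Matrix.of_apply]
  simp [Complex.mul_im]

/-- The entries of the output in terms of the memory `m` after the random numbers were drawn. -/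
lemma compressProg_run (ω : ℕ → ℝ) (s : State) (m : Mem) (hm : (sampleProg.run ω s).mem = m)
    (hidx : ∀ w < 5, (sampleProg.run ω s).idx w = s.idx w) :
    (∀ x < s.idx 0, ∀ i < s.idx 4, ∀ j < s.idx 4,
      (compressProg.run ω s).mem 5 [x, i, j] = compressSum (s.idx 3) m 1 [x] i j /
        ∑ i ∈ Finset.range (s.idx 4), compressSum (s.idx 3) m 1 [x] i i ∧
      (compressProg.run ω s).mem 6 [x, i, j] = compressSum (s.idx 3) m 2 [x] i j /
        ∑ i ∈ Finset.range (s.idx 4), compressSum (s.idx 3) m 1 [x] i i) ∧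
    (∀ y < s.idx 1, ∀ z < s.idx 2 - 1, ∀ i < s.idx 4, ∀ j < s.idx 4,
      (compressProg.run ω s).mem 7 [y, z, i, j] =
        compressSum (s.idx 3) m 3 [y, z] i j / (s.idx 4 * (1 + 18 * m 0 [])) ∧
      (compressProg.run ω s).mem 8 [y, z, i, j] =
        compressSum (s.idx 3) m 4 [y, z] i j / (s.idx 4 * (1 + 18 * m 0 []))) ∧
    (∀ y < s.idx 1, ∀ i < s.idx 4, ∀ j < s.idx 4,
      (compressProg.run ω s).mem 7 [y, s.idx 2 - 1, i, j] = (if i = j then 1 else 0) -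
        ∑ z ∈ Finset.range (s.idx 2 - 1),
          compressSum (s.idx 3) m 3 [y, z] i j / (s.idx 4 * (1 + 18 * m 0 [])) ∧
      (compressProg.run ω s).mem 8 [y, s.idx 2 - 1, i, j] = -
        ∑ z ∈ Finset.range (s.idx 2 - 1),
          compressSum (s.idx 3) m 4 [y, z] i j / (s.idx 4 * (1 + 18 * m 0 []))) := by
  have w2 := traceProg_writes
  have w3 := stateProg_writes (a := 1) (c := 5) (by norm_num) (by norm_num) (by norm_num)
  have w4 := stateProg_writes (a := 2) (c := 6) (by norm_num) (by norm_num) (by norm_num)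
  have w5 := effectProg_writes (a := 3) (c := 7) (by norm_num) (by norm_num) (by norm_num)
  have w6 := effectProg_writes (a := 4) (c := 8) (by norm_num) (by norm_num) (by norm_num)
  have w7 := lastEffectProg_writes (a := 3) (c := 7) (by norm_num) (by norm_num) (by norm_num)
    (init := deltaExp) (f := fun i j => 1 - ((i - j) + (j - i))) (fun _ => rfl)
  have w8 := lastEffectProg_writes (a := 4) (c := 8) (by norm_num) (by norm_num) (by norm_num)
    (init := .const 0) (f := fun _ _ => 0) (fun _ => rfl)
  simp only [compressProg, Prog.run]
  -- Each intermediate state is made opaque once three kinds of facts are recorded: `i` for the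
  -- input sizes, `m` and `n` for untouched arrays, `v` for computed values.
  generalize sampleProg.run ω s = s1 at hm hidx ⊢
  subst hm
  have i2 := fun w hw => (w2.idx_run ω s1 w hw).trans (hidx w hw)
  have m2 := fun a (ha : a ≠ 10) => w2.mem_of_ne ω s1 ha
  have v2 : ∀ x < s.idx 0, (traceProg.run ω s1).mem 10 [x] =
      ∑ i ∈ Finset.range (s.idx 4), compressSum (s.idx 3) s1.mem 1 [x] i i := fun x hx => by
    rw [w2.mem_of_mem ω s1 ⟨x, by rwa [hidx 0 (by norm_num)], rfl⟩]
    simp only [hidx 3 (by norm_num), hidx 4 (by norm_num)]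
  generalize traceProg.run ω s1 = s2 at i2 m2 v2 ⊢
  have i3 := fun w hw => (w3.idx_run ω s2 w hw).trans (i2 w hw)
  have m3 := fun a (ha : a ≠ 5) => w3.mem_of_ne ω s2 ha
  have v3 : ∀ x < s.idx 0, ∀ i < s.idx 4, ∀ j < s.idx 4,
      ((stateProg 1 5).run ω s2).mem 5 [x, i, j] = compressSum (s.idx 3) s1.mem 1 [x] i j /
        ∑ i ∈ Finset.range (s.idx 4), compressSum (s.idx 3) s1.mem 1 [x] i i :=
    fun x hx i hi j hj => by
    rw [w3.mem_of_mem ω s2 ⟨x, by rwa [i2 0 (by norm_num)], i, by rwa [i2 4 (by norm_num)], j,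
      by rwa [i2 4 (by norm_num)], rfl⟩]
    simp only [i2 3 (by norm_num), v2 x hx,
      compressSum_eq_of_eq (m2 9 (by norm_num)) (m2 1 (by norm_num))]
  generalize (stateProg 1 5).run ω s2 = s3 at i3 m3 v3 ⊢
  have i4 := fun w hw => (w4.idx_run ω s3 w hw).trans (i3 w hw)
  have m4 := fun a (ha : a ≠ 6) => w4.mem_of_ne ω s3 ha
  have v4 : ∀ x < s.idx 0, ∀ i < s.idx 4, ∀ j < s.idx 4,
      ((stateProg 2 6).run ω s3).mem 6 [x, i, j] = compressSum (s.idx 3) s1.mem 2 [x] i j /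
        ∑ i ∈ Finset.range (s.idx 4), compressSum (s.idx 3) s1.mem 1 [x] i i :=
    fun x hx i hi j hj => by
    rw [w4.mem_of_mem ω s3 ⟨x, by rwa [i3 0 (by norm_num)], i, by rwa [i3 4 (by norm_num)], j,
      by rwa [i3 4 (by norm_num)], rfl⟩]
    simp only [i3 3 (by norm_num), m3 10 (by norm_num), v2 x hx,
      compressSum_eq_of_eq ((m3 9 (by norm_num)).trans (m2 9 (by norm_num)))
        ((m3 2 (by norm_num)).trans (m2 2 (by norm_num)))]
  have n4 : ∀ a, a ≠ 10 → a ≠ 5 → a ≠ 6 → ((stateProg 2 6).run ω s3).mem a = s1.mem a :=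
    fun a h h' h'' => by rw [m4 a h'', m3 a h', m2 a h]
  have v4' := fun is => congrFun (m4 5 (by norm_num)) is
  generalize (stateProg 2 6).run ω s3 = s4 at i4 v4 n4 v4' ⊢
  have i5 := fun w hw => (w5.idx_run ω s4 w hw).trans (i4 w hw)
  have m5 := fun a (ha : a ≠ 7) => w5.mem_of_ne ω s4 ha
  have v5 : ∀ y < s.idx 1, ∀ z < s.idx 2 - 1, ∀ i < s.idx 4, ∀ j < s.idx 4,
      ((effectProg 3 7).run ω s4).mem 7 [y, z, i, j] =
        compressSum (s.idx 3) s1.mem 3 [y, z] i j / (s.idx 4 * (1 + 18 * s1.mem 0 [])) :=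
    fun y hy z hz i hi j hj => by
    rw [w5.mem_of_mem ω s4 ⟨y, by rwa [i4 1 (by norm_num)], z, by rwa [i4 2 (by norm_num)], i,
      by rwa [i4 4 (by norm_num)], j, by rwa [i4 4 (by norm_num)], rfl⟩]
    simp only [i4 3 (by norm_num), i4 4 (by norm_num), n4 0 (by norm_num) (by norm_num)
      (by norm_num), compressSum_eq_of_eq (n4 9 (by norm_num) (by norm_num) (by norm_num))
      (n4 3 (by norm_num) (by norm_num) (by norm_num))]
  generalize (effectProg 3 7).run ω s4 = s5 at i5 m5 v5 ⊢
  have i6 := fun w hw => (w6.idx_run ω s5 w hw).trans (i5 w hw)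
  have m6 := fun a (ha : a ≠ 8) => w6.mem_of_ne ω s5 ha
  have n5 : ∀ a, a ≠ 10 → a ≠ 5 → a ≠ 6 → a ≠ 7 → s5.mem a = s1.mem a :=
    fun a h h' h'' h3 => by rw [m5 a h3, n4 a h h' h'']
  have v6 : ∀ y < s.idx 1, ∀ z < s.idx 2 - 1, ∀ i < s.idx 4, ∀ j < s.idx 4,
      ((effectProg 4 8).run ω s5).mem 8 [y, z, i, j] =
        compressSum (s.idx 3) s1.mem 4 [y, z] i j / (s.idx 4 * (1 + 18 * s1.mem 0 [])) :=
    fun y hy z hz i hi j hj => by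
    rw [w6.mem_of_mem ω s5 ⟨y, by rwa [i5 1 (by norm_num)], z, by rwa [i5 2 (by norm_num)], i,
      by rwa [i5 4 (by norm_num)], j, by rwa [i5 4 (by norm_num)], rfl⟩]
    simp only [i5 3 (by norm_num), i5 4 (by norm_num), n5 0 (by norm_num) (by norm_num)
      (by norm_num) (by norm_num), compressSum_eq_of_eq
      (n5 9 (by norm_num) (by norm_num) (by norm_num) (by norm_num))
      (n5 4 (by norm_num) (by norm_num) (by norm_num) (by norm_num))]
  have n6 : ∀ a, a ≠ 10 → a ≠ 5 → a ≠ 6 → a ≠ 7 → a ≠ 8 →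
      ((effectProg 4 8).run ω s5).mem a = s1.mem a :=
    fun a h h' h'' h3 h4 => by rw [m6 a h4, n5 a h h' h'' h3]
  generalize (effectProg 4 8).run ω s5 = s6 at i6 m6 v6 n6 ⊢
  have i7 := fun w hw => (w7.idx_run ω s6 w hw).trans (i6 w hw)
  have m7 := fun a (ha : a ≠ 7) => w7.mem_of_ne ω s6 ha
  have v7 : ∀ y < s.idx 1, ∀ i < s.idx 4, ∀ j < s.idx 4,
      ((lastEffectProg 3 7 deltaExp).run ω s6).mem 7 [y, s.idx 2 - 1, i, j] =
        (if i = j then 1 else 0) - ∑ z ∈ Finset.range (s.idx 2 - 1),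
          compressSum (s.idx 3) s1.mem 3 [y, z] i j / (s.idx 4 * (1 + 18 * s1.mem 0 [])) :=
    fun y hy i hi j hj => by
    rw [w7.mem_of_mem ω s6 ⟨y, by rwa [i6 1 (by norm_num)], i, by rwa [i6 4 (by norm_num)], j,
      by rwa [i6 4 (by norm_num)], by rw [i6 2 (by norm_num)]⟩]
    simp only [i6 2 (by norm_num), i6 3 (by norm_num), i6 4 (by norm_num), n6 0 (by norm_num)
      (by norm_num) (by norm_num) (by norm_num) (by norm_num), compressSum_eq_of_eq
      (n6 9 (by norm_num) (by norm_num) (by norm_num) (by norm_num) (by norm_num))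
      (n6 3 (by norm_num) (by norm_num) (by norm_num) (by norm_num) (by norm_num))]
    congr 1
    split_ifs with h
    · simp [h]
    · rw [show 1 - (i - j + (j - i)) = 0 by omega, Nat.cast_zero]
  -- Array `7` is written twice; the second pass touches only the last outcome and keeps the earlier
  -- effects.
  have v7' : ∀ y, ∀ z < s.idx 2 - 1, ∀ i j,
      ((lastEffectProg 3 7 deltaExp).run ω s6).mem 7 [y, z, i, j] = s6.mem 7 [y, z, i, j] :=
    fun y z hz i j => by
    refine w7.mem_of_notMem ω s6 ?_
    rintro ⟨y', -, i', -, j', -, h⟩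
    rw [i6 2 (by norm_num)] at h
    simp only [List.cons.injEq] at h
    omega
  generalize (lastEffectProg 3 7 deltaExp).run ω s6 = s7 at i7 m7 v7 v7' ⊢
  have m8 := fun a (ha : a ≠ 8) => w8.mem_of_ne ω s7 ha
  have n7 : ∀ a, a ≠ 10 → a ≠ 5 → a ≠ 6 → a ≠ 7 → a ≠ 8 → s7.mem a = s1.mem a :=
    fun a h h' h'' h3 h4 => by rw [m7 a h3, n6 a h h' h'' h3 h4]
  have v8 : ∀ y < s.idx 1, ∀ i < s.idx 4, ∀ j < s.idx 4,
      ((lastEffectProg 4 8 (.const 0)).run ω s7).mem 8 [y, s.idx 2 - 1, i, j] =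
        -∑ z ∈ Finset.range (s.idx 2 - 1),
          compressSum (s.idx 3) s1.mem 4 [y, z] i j / (s.idx 4 * (1 + 18 * s1.mem 0 [])) :=
    fun y hy i hi j hj => by
    rw [w8.mem_of_mem ω s7 ⟨y, by rwa [i7 1 (by norm_num)], i, by rwa [i7 4 (by norm_num)], j,
      by rwa [i7 4 (by norm_num)], by rw [i7 2 (by norm_num)]⟩]
    simp only [i7 2 (by norm_num), i7 3 (by norm_num), i7 4 (by norm_num), n7 0 (by norm_num)
      (by norm_num) (by norm_num) (by norm_num) (by norm_num), compressSum_eq_of_eq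
      (n7 9 (by norm_num) (by norm_num) (by norm_num) (by norm_num) (by norm_num))
      (n7 4 (by norm_num) (by norm_num) (by norm_num) (by norm_num) (by norm_num)),
      Nat.cast_zero, zero_sub]
  have v8' : ∀ y, ∀ z < s.idx 2 - 1, ∀ i j,
      ((lastEffectProg 4 8 (.const 0)).run ω s7).mem 8 [y, z, i, j] = s7.mem 8 [y, z, i, j] :=
    fun y z hz i j => by
    refine w8.mem_of_notMem ω s7 ?_
    rintro ⟨y', -, i', -, j', -, h⟩
    rw [i7 2 (by norm_num)] at h
    simp only [List.cons.injEq] at h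
    omega
  refine ⟨fun x hx i hi j hj => ⟨?_, ?_⟩, fun y hy z hz i hi j hj => ⟨?_, ?_⟩,
    fun y hy i hi j hj => ⟨?_, v8 y hy i hi j hj⟩⟩
  · rw [m8 5 (by norm_num), m7 5 (by norm_num), m6 5 (by norm_num), m5 5 (by norm_num), v4',
      v3 x hx i hi j hj]
  · rw [m8 6 (by norm_num), m7 6 (by norm_num), m6 6 (by norm_num), m5 6 (by norm_num),
      v4 x hx i hi j hj]
  · rw [m8 7 (by norm_num), v7' y z hz, m6 7 (by norm_num), v5 y hy z hz i hi j hj]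
  · rw [v8' y z hz, m7 8 (by norm_num), v6 y hy z hz i hi j hj]
  · rw [m8 7 (by norm_num), v7 y hy i hi j hj]

/-- An identity for every `ω`, even if a compressed trace vanishes: division by zero and the inverse
of zero both return zero. -/
theorem compressProg_output {X Y K D : ℕ} (d : ℕ) (ε : ℝ)
    (ρ : Fin X → Matrix (Fin D) (Fin D) ℂ) (E : Fin Y → Fin (K + 1) → Matrix (Fin D) (Fin D) ℂ)
    (ω : ℕ → ℝ) :
    outputRho X d (compressProg.run ω (inputState d ε ρ E)) =
        compressedState (sourceMatrix d D ω) ρ ∧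
      outputE Y (K + 1) d (compressProg.run ω (inputState d ε ρ E)) =
        fun y => compressedPOVM ε (sourceMatrix d D ω) (E y) := by
  obtain ⟨h9, hm, hidx⟩ := sampleProg_run ω (inputState d ε ρ E) rfl
  obtain ⟨o1, o2, o3⟩ := compressProg_run ω (inputState d ε ρ E) _ rfl hidx
  generalize (sampleProg.run ω (inputState d ε ρ E)).mem = m at h9 hm o1 o2 o3
  generalize compressProg.run ω (inputState d ε ρ E) = t at o1 o2 o3 ⊢
  simp only [show (inputState d ε ρ E).idx 0 = X from rfl,
    show (inputState d ε ρ E).idx 1 = Y from rfl, show (inputState d ε ρ E).idx 2 = K + 1 from rfl,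
    show (inputState d ε ρ E).idx 3 = D from rfl, show (inputState d ε ρ E).idx 4 = d from rfl,
    Nat.add_sub_cancel] at h9 o1 o2 o3
  set G := sourceMatrix d D ω
  have hre : ∀ (x : Fin X) (i j : Fin d), compressSum D m 1 [(x : ℕ)] i j =
      (compress G (ρ x) i j).re := fun x => by
    refine compressSum_eq_re h9 fun k l => ?_
    rw [hm 1 (by norm_num)]
    simp [inputState, inputMem, entry]
  have him : ∀ (x : Fin X) (i j : Fin d), compressSum D m 2 [(x : ℕ)] i j =
      (compress G (ρ x) i j).im := fun x => by
    refine compressSum_eq_im h9 fun k l => ?_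
    rw [hm 2 (by norm_num)]
    simp [inputState, inputMem, entry]
  have hEre : ∀ (y : Fin Y) (z : Fin (K + 1)) (i j : Fin d),
      compressSum D m 3 [(y : ℕ), (z : ℕ)] i j = (compress G (E y z) i j).re := fun y z => by
    refine compressSum_eq_re h9 fun k l => ?_
    rw [hm 3 (by norm_num)]
    have := z.is_lt
    simp [inputState, inputMem, entry, this]
  have hEim : ∀ (y : Fin Y) (z : Fin (K + 1)) (i j : Fin d),
      compressSum D m 4 [(y : ℕ), (z : ℕ)] i j = (compress G (E y z) i j).im := fun y z => by
    refine compressSum_eq_im h9 fun k l => ?_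
    rw [hm 4 (by norm_num)]
    have := z.is_lt
    simp [inputState, inputMem, entry, this]
  have hε : m 0 [] = ε := by rw [hm 0 (by norm_num)]; rfl
  have htr : ∀ x : Fin X, ∑ i ∈ Finset.range d, compressSum D m 1 [(x : ℕ)] i i =
      (compress G (ρ x)).trace.re := fun x => by
    rw [Finset.sum_range, Matrix.trace, Complex.re_sum]
    exact Finset.sum_congr rfl fun i _ => hre x i i
  have hce : ∀ M i j, (compressedEffect ε G M i j).re =
      (compress G M i j).re / (d * (1 + 18 * ε)) ∧ (compressedEffect ε G M i j).im =
      (compress G M i j).im / (d * (1 + 18 * ε)) := fun M i j => by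
    rw [compressedEffect, Matrix.smul_apply, smul_eq_mul, Complex.re_ofReal_mul,
      Complex.im_ofReal_mul, div_eq_inv_mul, div_eq_inv_mul]
    exact ⟨rfl, rfl⟩
  constructor
  · ext x i j
    obtain ⟨e1, e2⟩ := o1 x x.2 i i.2 j j.2
    rw [hre, htr] at e1
    rw [him, htr] at e2
    rw [outputRho, Matrix.of_apply, compressedState, Matrix.smul_apply, smul_eq_mul, e1, e2]
    apply Complex.ext
    · rw [Complex.re_ofReal_mul]; exact div_eq_inv_mul _ _
    · rw [Complex.im_ofReal_mul]; exact div_eq_inv_mul _ _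
  · ext y z i j
    rw [outputE, Matrix.of_apply]
    refine Fin.lastCases ?_ (fun k => ?_) z
    · obtain ⟨e1, e2⟩ := o3 y y.2 i i.2 j j.2
      rw [Finset.sum_range, hε] at e1 e2
      have e3 := fun k : Fin K => hEre y k.castSucc i j
      have e4 := fun k : Fin K => hEim y k.castSucc i j
      simp only [Fin.val_castSucc] at e3 e4
      simp only [e3] at e1
      simp only [e4] at e2
      rw [compressedPOVM, Fin.lastCases_last, Fin.val_last]
      apply Complex.ext
      · refine e1.trans ?_
        rw [Matrix.sub_apply, Complex.sub_re, Matrix.sum_apply, Complex.re_sum, Matrix.one_apply]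
        simp only [hce, Fin.ext_iff]
        split_ifs <;> simp
      · refine e2.trans ?_
        rw [Matrix.sub_apply, Complex.sub_im, Matrix.sum_apply, Complex.im_sum, Matrix.one_apply]
        simp only [hce]
        split_ifs <;> simp
    · obtain ⟨e1, e2⟩ := o2 y y.2 k k.2 i i.2 j j.2
      have e3 := hEre y k.castSucc i j
      have e4 := hEim y k.castSucc i j
      rw [Fin.val_castSucc] at e3 e4
      rw [e3, hε] at e1
      rw [e4, hε] at e2
      rw [compressedPOVM, Fin.lastCases_castSucc, Fin.val_castSucc]
      apply Complex.ext
      · exact e1.trans (hce _ i j).1.symm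
      · exact e2.trans (hce _ i j).2.symm

end RealRAM

end

/-! ### Assembly of the theorem -/

theorem theorem4 :
    ∃ (P : RealRAM.Prog) (p : Polynomial ℕ),
      ∀ (X Y K D d jstar : ℕ) (b ε : ℝ)
        (ρ : Fin X → Matrix (Fin D) (Fin D) ℂ)
        (E : Fin Y → Fin (K + 1) → Matrix (Fin D) (Fin D) ℂ),
        0 < D →
        (∀ x, IsQuantumState (ρ x)) →
        (∀ y, IsPOVM (E y)) →
        0 < jstar →
        0 < b →
        (∀ y, HasExpTail (sumButLast (E y)) jstar b) →
        0 < ε →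
        ε ≤ 1 / 2 →
        128 / ε ^ 2 * Real.log (4 * ((X : ℝ) + Y * (K + 1)) * D) ≤ d →
        128 / ε ^ 2 * (jstar + 1 / b * Real.log (8 / ε)) ≤ d →
        -- existence of the compressed model
        (∃ (ρ' : Fin X → Matrix (Fin d) (Fin d) ℂ)
            (E' : Fin Y → Fin (K + 1) → Matrix (Fin d) (Fin d) ℂ),
          IsCompressedModel ε ρ E ρ' E') ∧
        -- the program always stops within polynomially many steps
        (∀ ω : ℕ → ℝ,
          (P.run ω (RealRAM.inputState d ε ρ E)).steps ≤ p.eval (X + Y + (K + 1) + max D d)) ∧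
        -- and fails to return a compressed model with probability at most `1 / 3`
        RealRAM.gaussianSource
            {ω : ℕ → ℝ | ¬ IsCompressedModel ε ρ E
              (RealRAM.outputRho X d (P.run ω (RealRAM.inputState d ε ρ E)))
              (RealRAM.outputE Y (K + 1) d (P.run ω (RealRAM.inputState d ε ρ E)))}
          ≤ 1 / 3 := by
  classical
  refine ⟨RealRAM.compressProg, RealRAM.compressProg.stepBound, ?_⟩
  intro X Y K D d jstar b ε ρ E hD hρ hE hj hb hT h0 hε h1 h2
  have hfail : RealRAM.gaussianSource
      {ω : ℕ → ℝ | ¬ IsCompressedModel ε ρ E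
        (RealRAM.outputRho X d (RealRAM.compressProg.run ω (RealRAM.inputState d ε ρ E)))
        (RealRAM.outputE Y (K + 1) d (RealRAM.compressProg.run ω (RealRAM.inputState d ε ρ E)))}
      ≤ 1 / 3 := by
    -- For `X = Y = 0` every output is correct vacuously. This is the case `J = 0`, where `Real.log
    -- 0 = 0` makes the first condition on `d` void.
    rcases Nat.eq_zero_or_pos (X + Y) with hXY | hXY
    · obtain ⟨rfl, rfl⟩ : X = 0 ∧ Y = 0 := by omega
      have : ∀ ρ' E', IsCompressedModel (d := d) ε ρ E ρ' E' := fun ρ' E' =>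
        ⟨fun x => x.elim0, fun y => y.elim0, fun x => x.elim0, fun x => x.elim0⟩
      simp [this]
    · have hd : 0 < d := by
        have hlog : 0 < Real.log (8 / ε) := Real.log_pos (by rw [lt_div_iff₀ h0]; linarith)
        have hpos : (0 : ℝ) < 128 / ε ^ 2 * (jstar + 1 / b * Real.log (8 / ε)) := by positivity
        exact_mod_cast hpos.trans_le h2
      choose v hv using fun x => GaussianCompression.exists_eq_sum_outer (hρ x).posSemidef
      choose c hc using fun y (k : Fin K) =>
        GaussianCompression.exists_eq_sum_outer ((hE y).posSemidef k.castSucc)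
      have hgood := GaussianCompression.measure_not_isGood_le hD hXY hE hj hb hT h0 hε h1 h2 v c
      rw [← ENNReal.toReal_le_toReal (MeasureTheory.measure_ne_top _ _) (by simp)]
      -- Only monotonicity is used, so the failure event need not be shown measurable.
      refine (MeasureTheory.measureReal_mono (?_ : _ ⊆ {ω | ¬ GaussianCompression.IsGood ε
        (GaussianCompression.sourceMatrix d D ω) E v c}) (MeasureTheory.measure_ne_top _ _)).trans
        (hgood.trans (by simp))
      intro ω hω hG
      obtain ⟨e1, e2⟩ := RealRAM.compressProg_output d ε ρ E ω
      apply hω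
      rw [e1, e2]
      exact hG.isCompressedModel hd h0 hε hρ hE hv hc
  refine ⟨?_, fun ω => ?_, hfail⟩
  -- Without any compressed model, failure would be certain, and `1 ≤ 1/3` is false.
  · by_contra hcon
    have huniv : {ω : ℕ → ℝ | ¬ IsCompressedModel ε ρ E
        (RealRAM.outputRho X d (RealRAM.compressProg.run ω (RealRAM.inputState d ε ρ E)))
        (RealRAM.outputE Y (K + 1) d
          (RealRAM.compressProg.run ω (RealRAM.inputState d ε ρ E)))} = Set.univ :=
      Set.eq_univ_of_forall fun ω hω => hcon ⟨_, _, hω⟩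
    rw [huniv, MeasureTheory.measure_univ] at hfail
    exact absurd hfail (by
      rw [not_le, one_div]
      exact ENNReal.inv_lt_one.2 (by norm_num))
  · refine (RealRAM.Prog.steps_run_le (N := X + Y + (K + 1) + max D d) ω _ RealRAM.compressProg_isSized _ fun w hw => ?_).1.trans
      (by simp [RealRAM.inputState])
    interval_cases w <;> simp only [RealRAM.inputState, RealRAM.inputIdx] <;> omega
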